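/- Let $d\ge 1$, write points of $\mathbb R^d$ as $x=(x',x_d)$ with $x'\in\mathbb R^{d-1}$, and let $s\in(0,1)$, $p\in(1,\infty)$. For an open set $\Omega\subset\mathbb R^d$ let $[C^1_c(\Omega)]^d$ be the space of $C^1$ vector fields $u:\Omega\to\mathbb R^d$ whose support is a compact subset of $\Omega$, and put $$[u]_{\mathcal X^{s,p}(\Omega)}^p=\int_\Omega\int_\Omega\frac{\bigl|(u(x)-u(y))\cdot\frac{x-y}{|x-y|}\bigr|^p}{|x-y|^{d+sp}}\,dy\,dx,\qquad |u|_{W^{s,p}(\Omega)}^p=\int_\Omega\int_\Omega\frac{|u(x)-u(y)|^p}{|x-y|^{d+sp}}\,dy\,dx,$$ $\|u\|_{\mathcal X^{s,p}(\Omega)}=[u]_{\mathcal X^{s,p}(\Omega)}+\|u\|_{L^p(\Omega)}$, $\|u\|_{W^{s,p}(\Omega)}=|u|_{W^{s,p}(\Omega)}+\|u\|_{L^p(\Omega)}$, $\|u\|_{C^1(\Omega)}=\sup_\Omega|u|+\sup_\Omega|\nabla u|$. Let $f:\mathbb R^{d-1}\to\mathbb R$ be $C^1$ and globally Lipschitz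 with $f(0)=0$, $\nabla f(0)=0$; its Lipschitz constant is $M=\|\nabla f\|_{L^\infty(\mathbb R^{d-1})}$, and the epigraph supported by $f$ is $D=\{x\in\mathbb R^d: x_d>f(x')\}$. For $\eta>0$ let $\Phi_\eta(x)=(x',f(x')+\eta(f(x')-x_d))$. There exist a universal constant $M_0>0$ and universal real constants $\lambda,\mu>0$ and $k,\ell,m,n$ with $k+\ell=1=m+n$, $\lambda k=-m$, $\mu\ell=-n$ such that, for all $d,s,p$ as above, there is a constant $C$ depending only on $d$, $s$, $p$ (and $M_0$) with the following property. For every epigraph $D$ supported by a function $f$ as above with $M<M_0$ there is a linear operator $$E:[C^1_c(D)]^d\to[C^1_c(\mathbb R^d)]^d$$ such that for every $u\in[C^1_c(D)]^d$: $Eu=u$ on $D$; for every $x$ with $x_d<f(x')$, $$(Eu)_i(x)=k\,u_i(\Phi_\lambda(x))+\ell\,u_i(\Phi_\mu(x))\ (1\le i\le d-1),\qquad (Eu)_d(x)=m\,u_d(\Phi_\lambda(x))+n\,u_d(\Phi_\mu(x));$$ and $$\|Eu\|_{C^1(\mathbb R^d)}\le C\|u\|_{C^1(D)},\qquad \|Eu\|_{\mathcal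 X^{s,p}(\mathbb R^d)}\le C\bigl(\|u\|_{\mathcal X^{s,p}(D)}+M\|u\|_{W^{s,p}(D)}\bigr).$$ -/

import Mathlib

open MeasureTheory Set
open scoped ENNReal NNReal

noncomputable section

namespace FracKorn

/-- The Aronszajn–Slobodeckij–Gagliardo seminorm `|u|_{W^{s,p}(Ω)}`, with values in `[0, ∞]`. -/
def gagliardoSeminorm {d : ℕ} (s p : ℝ) (Ω : Set (EuclideanSpace ℝ (Fin d)))
    (u : EuclideanSpace ℝ (Fin d) → EuclideanSpace ℝ (Fin d)) : ℝ≥0∞ :=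
  (∫⁻ x in Ω, ∫⁻ y in Ω,
    ENNReal.ofReal (‖u x - u y‖ ^ p / ‖x - y‖ ^ ((d : ℝ) + s * p))) ^ (1 / p)

/-- The seminorm `[u]_{𝒳^{s,p}(Ω)}` of the projected difference
`(u x - u y) · (x - y) / |x - y|`, with values in `[0, ∞]`. -/
def projSeminorm {d : ℕ} (s p : ℝ) (Ω : Set (EuclideanSpace ℝ (Fin d)))
    (u : EuclideanSpace ℝ (Fin d) → EuclideanSpace ℝ (Fin d)) : ℝ≥0∞ :=
  (∫⁻ x in Ω, ∫⁻ y in Ω,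
    ENNReal.ofReal (|inner ℝ (u x - u y) (‖x - y‖⁻¹ • (x - y))| ^ p
      / ‖x - y‖ ^ ((d : ℝ) + s * p))) ^ (1 / p)

/-- The norm of `L^p(Ω)`. -/
def lpNorm {d : ℕ} (p : ℝ) (Ω : Set (EuclideanSpace ℝ (Fin d)))
    (u : EuclideanSpace ℝ (Fin d) → EuclideanSpace ℝ (Fin d)) : ℝ≥0∞ :=
  eLpNorm u (ENNReal.ofReal p) (volume.restrict Ω)

/-- The norm `‖u‖_{W^{s,p}(Ω)} = |u|_{W^{s,p}(Ω)} + ‖u‖_{L^p(Ω)}`. -/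
def normW {d : ℕ} (s p : ℝ) (Ω : Set (EuclideanSpace ℝ (Fin d)))
    (u : EuclideanSpace ℝ (Fin d) → EuclideanSpace ℝ (Fin d)) : ℝ≥0∞ :=
  gagliardoSeminorm s p Ω u + lpNorm p Ω u

/-- The norm `‖u‖_{𝒳^{s,p}(Ω)} = [u]_{𝒳^{s,p}(Ω)} + ‖u‖_{L^p(Ω)}`. -/
def normX {d : ℕ} (s p : ℝ) (Ω : Set (EuclideanSpace ℝ (Fin d)))
    (u : EuclideanSpace ℝ (Fin d) → EuclideanSpace ℝ (Fin d)) : ℝ≥0∞ :=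
  projSeminorm s p Ω u + lpNorm p Ω u

/-- The `C^1` norm on `Ω`: `sup_Ω |u| + sup_Ω |∇u|`. -/
def normC1 {d : ℕ} (Ω : Set (EuclideanSpace ℝ (Fin d)))
    (u : EuclideanSpace ℝ (Fin d) → EuclideanSpace ℝ (Fin d)) : ℝ≥0∞ :=
  (⨆ x ∈ Ω, ‖u x‖ₑ) + ⨆ x ∈ Ω, ‖fderiv ℝ u x‖ₑ

/-- The space `[C^1_c(Ω)]^d`, for open `Ω`: the continuously differentiable vector fields whose
support is a compact subset of `Ω`. Such a field is identified with its extension by zero to the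
whole space. -/
def C1c {d : ℕ} (Ω : Set (EuclideanSpace ℝ (Fin d))) :
    Submodule ℝ (EuclideanSpace ℝ (Fin d) → EuclideanSpace ℝ (Fin d)) where
  carrier := {u | ContDiff ℝ 1 u ∧ HasCompactSupport u ∧ tsupport u ⊆ Ω}
  zero_mem' := by
    refine ⟨contDiff_const, HasCompactSupport.zero, ?_⟩
    simp [tsupport]
  add_mem' := by
    rintro u v ⟨hu, hu', hu''⟩ ⟨hv, hv', hv''⟩
    exact ⟨hu.add hv, hu'.add hv', (tsupport_add u v).trans (union_subset hu'' hv'')⟩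
  smul_mem' := by
    rintro c u ⟨hu, hu', hu''⟩
    exact ⟨contDiff_const.smul hu, hu'.smul_left (f := fun _ => c),
      (tsupport_smul_subset_right (fun _ => c) u).trans hu''⟩

/-- The first `n` coordinates `x'` of a point `x = (x', x_{n+1})` of `ℝ^{n+1}`. -/
def horiz {n : ℕ} (x : EuclideanSpace ℝ (Fin (n + 1))) : EuclideanSpace ℝ (Fin n) :=
  WithLp.toLp 2 fun i => x i.castSucc

/-- The last coordinate of a point of `ℝ^{n+1}`. -/
def vert {n : ℕ} (x : EuclideanSpace ℝ (Fin (n + 1))) : ℝ :=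
  x (Fin.last n)

/-- Admissible graph functions: `C^1`, globally Lipschitz, with `f(0) = 0` and `∇f(0) = 0`. -/
structure IsSupporting {n : ℕ} (f : EuclideanSpace ℝ (Fin n) → ℝ) : Prop where
  contDiff : ContDiff ℝ 1 f
  lipschitz : ∃ K : ℝ≥0, LipschitzWith K f
  map_zero : f 0 = 0
  grad_zero : gradient f 0 = 0

/-- The Lipschitz constant `M = ‖∇f‖_{L^∞(ℝ^n)}`. -/
def lipConst {n : ℕ} (f : EuclideanSpace ℝ (Fin n) → ℝ) : ℝ≥0∞ :=
  eLpNorm (gradient f) ∞ volume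

/-- The epigraph supported by `f`. -/
def epigraph {n : ℕ} (f : EuclideanSpace ℝ (Fin n) → ℝ) :
    Set (EuclideanSpace ℝ (Fin (n + 1))) :=
  {x | f (horiz x) < vert x}

/-- The open region below the graph of `f`. -/
def hypograph {n : ℕ} (f : EuclideanSpace ℝ (Fin n) → ℝ) :
    Set (EuclideanSpace ℝ (Fin (n + 1))) :=
  {x | vert x < f (horiz x)}

/-- The reflection `(x', x_d) ↦ (x', f(x') + η (f(x') - x_d))` across the graph of `f`. -/
def reflection {n : ℕ} (f : EuclideanSpace ℝ (Fin n) → ℝ) (η : ℝ)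
    (x : EuclideanSpace ℝ (Fin (n + 1))) : EuclideanSpace ℝ (Fin (n + 1)) :=
  WithLp.toLp 2 (Fin.snoc (α := fun _ => ℝ) (fun i => x i.castSucc)
    (f (horiz x) + η * (f (horiz x) - vert x)))

end FracKorn

end

/-! Take λ = 1, μ = 2, so that Φ_1 and Φ_2 are `vshift` with parameters 2 and 3, and split the
double integral of Eu according to the sides of the graph on which x and y lie. The graph itself is
a null set.

Both points below: because λk = -m and μℓ = -n, over a flat graph each reflected term contributes an
exact multiple of the projected difference of u at the reflected points. Over a curved graph the
error is f(x') - f(y') times a difference of u_d, which costs M and the seminorm of W^{s,p}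
(`projDiff_extendField_below`, `lintegral_below_below_le`).

One point x below, one point y above: k + ℓ = 1 = m + n makes u(y) enter with the right coefficient.
What remains is Δ(x) = u_d(Φ_1 x) - u_d(Φ_2 x), without any factor M (`projDiff_extendField_cross`).
Integrating in y leaves |Δ|^p weighted by depth(x)^{-sp}. Up to the factor depth(x), Δ is a
projected difference along a vertical segment. By `projDiff_parallelogram` it is a combination of
projected differences along the four sides and the other diagonal of a parallelogram. Averaging over
that second diagonal turns the weighted integral of |Δ|^p into a double integral of the projected
kernel over the epigraph (`lintegral_vertical_diff_le`).

All substitutions use only Lipschitz bounds for inverse maps, hence constants independent of f once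
M ≤ 1. Since u vanishes on and below the graph, E is given by one formula on the whole space, so
smoothness needs no gluing. -/

namespace FracKorn

/-! ### Change of variables through Lipschitz inverses. -/

section LipschitzImages

variable {V : Type*} [NormedAddCommGroup V] [NormedSpace ℝ V] [FiniteDimensional ℝ V]
  [MeasurableSpace V] [BorelSpace V] (μ : Measure V) [μ.IsAddHaarMeasure]

/-- A `K`-Lipschitz map increases Haar measure at most by the factor `K ^ d`. -/
theorem measure_image_le_of_lipschitz {K : ℝ≥0} {g : V → V} (hg : LipschitzWith K g) (s : Set V) :
    μ (g '' s) ≤ (K : ℝ≥0∞) ^ Module.finrank ℝ V * μ s := by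
  have h := hg.hausdorffMeasure_image_le (d := (Module.finrank ℝ V : ℝ)) (by positivity) s
  rw [Measure.isAddLeftInvariant_eq_smul μ (Measure.hausdorffMeasure (Module.finrank ℝ V : ℝ))]
  simp only [Measure.smul_apply, ENNReal.smul_def, smul_eq_mul]
  rw [ENNReal.rpow_natCast] at h
  calc _ ≤ _ := mul_le_mul_right h _
    _ = _ := by ring

/-- The image of Haar measure under a map with a `K`-Lipschitz left inverse. -/
theorem map_le_of_leftInverse {K : ℝ≥0} {g h : V → V} (hg : LipschitzWith K g)
    (hgh : Function.LeftInverse g h) (hh : Measurable h) :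
    μ.map h ≤ (K : ℝ≥0∞) ^ Module.finrank ℝ V • μ := by
  refine Measure.le_iff.2 fun s hs => ?_
  rw [Measure.map_apply hh hs, Measure.smul_apply, smul_eq_mul]
  refine le_trans (measure_mono fun x hx => ?_) (measure_image_le_of_lipschitz μ hg s)
  exact ⟨h x, hx, hgh x⟩

/-- Substitution along a map with a `K`-Lipschitz left inverse. -/
theorem lintegral_comp_le_of_leftInverse {K : ℝ≥0} {g h : V → V} (hg : LipschitzWith K g)
    (hgh : Function.LeftInverse g h) (hh : Measurable h) {F : V → ℝ≥0∞} (hF : Measurable F) :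
    ∫⁻ x, F (h x) ∂μ ≤ (K : ℝ≥0∞) ^ Module.finrank ℝ V * ∫⁻ x, F x ∂μ := by
  rw [← lintegral_map hF hh, ← smul_eq_mul, ← lintegral_smul_measure]
  exact lintegral_mono' (map_le_of_leftInverse μ hg hgh hh) le_rfl

end LipschitzImages

/-! ### Geometry of the vertical reflections. -/

section VerticalShift

variable {V : Type*} [NormedAddCommGroup V] [InnerProductSpace ℝ V]

/-- `e` is a unit vector and `φ` is an `M`-Lipschitz function, constant in the direction `e`,
with `M ≤ 1`. -/
structure IsGraphFunction (e : V) (φ : V → ℝ) (M : ℝ≥0) : Prop where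
  norm_eq : ‖e‖ = 1
  invariant : ∀ x (t : ℝ), φ (x + t • e) = φ x
  lipschitz : LipschitzWith M φ
  le_one : M ≤ 1

/-- The signed vertical distance of `x` to the graph of `φ`, positive below the graph. -/
def depth (e : V) (φ : V → ℝ) (x : V) : ℝ := φ x - inner ℝ e x

/-- The map moving `x` upwards by `t` times its depth. -/
def vshift (e : V) (φ : V → ℝ) (t : ℝ) (x : V) : V := x + (t * depth e φ x) • e

namespace IsGraphFunction

variable {e : V} {φ : V → ℝ} {M : ℝ≥0} (H : IsGraphFunction e φ M)
include H

theorem inner_self : inner ℝ e e = 1 := by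
  rw [real_inner_self_eq_norm_sq, H.norm_eq, one_pow]

theorem depth_add_smul (x : V) (t : ℝ) : depth e φ (x + t • e) = depth e φ x - t := by
  simp only [depth, H.invariant, inner_add_right, inner_smul_right, H.inner_self]
  ring

theorem depth_vshift (t : ℝ) (x : V) :
    depth e φ (vshift e φ t x) = (1 - t) * depth e φ x := by
  rw [vshift, H.depth_add_smul]; ring

/-- Depth is affine along `e`, so these maps are closed under composition. For t ≠ 1 the inverse has
parameter t / (t - 1): the parameters 2, 3, 5/2 are inverted by 2, 3/2, 5/3. -/
theorem vshift_vshift (s t : ℝ) (x : V) :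
    vshift e φ s (vshift e φ t x) = vshift e φ (t + s * (1 - t)) x := by
  rw [vshift, H.depth_vshift, vshift, vshift, add_assoc, ← add_smul]
  congr 2; ring

theorem leftInverse_vshift {s t : ℝ} (h : t + s * (1 - t) = 0) :
    Function.LeftInverse (vshift e φ s) (vshift e φ t) := fun x => by
  rw [H.vshift_vshift, h]; simp [vshift]

theorem abs_sub_le (x y : V) : |φ x - φ y| ≤ M * ‖x - y‖ := by
  simpa [Real.dist_eq, dist_eq_norm] using H.lipschitz.dist_le_mul x y

theorem abs_inner_le (x : V) : |inner ℝ e x| ≤ ‖x‖ := by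
  simpa [H.norm_eq] using abs_real_inner_le_norm e x

/-- This is where M ≤ 1 enters: it makes the later constants uniform over all graphs. -/
theorem abs_depth_sub_le (x y : V) : |depth e φ x - depth e φ y| ≤ 2 * ‖x - y‖ := by
  have h1 := H.abs_sub_le x y
  have h2 := H.abs_inner_le (x - y)
  have h3 : (M : ℝ) * ‖x - y‖ ≤ 1 * ‖x - y‖ :=
    mul_le_mul_of_nonneg_right (by exact_mod_cast H.le_one) (norm_nonneg _)
  have h4 : depth e φ x - depth e φ y = (φ x - φ y) - inner ℝ e (x - y) := by
    simp only [depth, inner_sub_right]; ring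
  rw [h4]
  calc _ ≤ |φ x - φ y| + |inner ℝ e (x - y)| := abs_sub _ _
    _ ≤ _ := by linarith

theorem lipschitzWith_vshift {t : ℝ} (ht : |t| ≤ 3) : LipschitzWith 7 (vshift e φ t) := by
  refine LipschitzWith.of_dist_le_mul fun x y => ?_
  rw [dist_eq_norm, dist_eq_norm]
  have h : vshift e φ t x - vshift e φ t y
      = (x - y) + (t * (depth e φ x - depth e φ y)) • e := by
    simp only [vshift, mul_sub, sub_smul]; abel
  rw [h]
  refine (norm_add_le _ _).trans ?_
  rw [norm_smul, H.norm_eq, mul_one, Real.norm_eq_abs, abs_mul]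
  have := mul_le_mul ht (H.abs_depth_sub_le x y) (abs_nonneg _) (by norm_num)
  push_cast
  linarith

theorem continuous_depth : Continuous (depth e φ) := by
  have := H.lipschitz.continuous
  unfold depth; fun_prop

theorem continuous_vshift (t : ℝ) : Continuous (vshift e φ t) := by
  have := H.continuous_depth
  unfold vshift; fun_prop

theorem norm_vshift_sub_le {t : ℝ} (ht : |t| ≤ 3) (x y : V) :
    ‖vshift e φ t x - vshift e φ t y‖ ≤ 7 * ‖x - y‖ := by
  simpa [dist_eq_norm] using (H.lipschitzWith_vshift ht).dist_le_mul x y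

theorem depth_le {x y : V} (hy : depth e φ y < 0) : depth e φ x ≤ 2 * ‖x - y‖ := by
  have := (le_abs_self _).trans (H.abs_depth_sub_le x y)
  linarith

theorem norm_vshift_sub_le_of_depth {t : ℝ} (ht : |t| ≤ 3) {x y : V} (hx : 0 < depth e φ x)
    (hy : depth e φ y < 0) : ‖vshift e φ t x - y‖ ≤ 7 * ‖x - y‖ := by
  have h : vshift e φ t x - y = (x - y) + (t * depth e φ x) • e := by
    simp only [vshift]; abel
  rw [h]
  refine (norm_add_le _ _).trans ?_
  rw [norm_smul, H.norm_eq, mul_one, Real.norm_eq_abs, abs_mul, abs_of_pos hx]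
  have := mul_le_mul ht (H.depth_le (x := x) hy) hx.le (by norm_num)
  linarith

variable [FiniteDimensional ℝ V] [MeasurableSpace V] [BorelSpace V] (μ : Measure V)
  [μ.IsAddHaarMeasure]

theorem map_vshift_le {s t : ℝ} (hs : |s| ≤ 3) (hst : t + s * (1 - t) = 0) :
    μ.map (vshift e φ t) ≤ (7 : ℝ≥0∞) ^ Module.finrank ℝ V • μ :=
  map_le_of_leftInverse μ (H.lipschitzWith_vshift hs) (H.leftInverse_vshift hst)
    (H.continuous_vshift t).measurable

theorem lintegral_comp_vshift_le {s t : ℝ} (hs : |s| ≤ 3) (hst : t + s * (1 - t) = 0)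
    {F : V → ℝ≥0∞} (hF : Measurable F) :
    ∫⁻ x, F (vshift e φ t x) ∂μ ≤ 7 ^ Module.finrank ℝ V * ∫⁻ x, F x ∂μ :=
  lintegral_comp_le_of_leftInverse μ (H.lipschitzWith_vshift hs) (H.leftInverse_vshift hst)
    (H.continuous_vshift t).measurable hF

/-- The graph is a null set. -/
theorem measure_graph : μ {x | depth e φ x = 0} = 0 := by
  have hne : e ≠ 0 := fun h => by simpa [h] using H.norm_eq
  set S : Submodule ℝ V := (innerSL ℝ e).ker
  have hS : S ≠ ⊤ := fun h => by
    have : e ∈ S := h ▸ Submodule.mem_top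
    have h2 : inner ℝ e e = 0 := by simpa [S] using this
    exact hne (inner_self_eq_zero.1 h2)
  -- The graph is the image of the hyperplane orthogonal to `e`, which is null, under this Lipschitz
  -- map.
  have hL : LipschitzWith (M + 1) fun x => x + φ x • e := by
    refine LipschitzWith.of_dist_le_mul fun x y => ?_
    rw [dist_eq_norm, dist_eq_norm]
    have h : x + φ x • e - (y + φ y • e) = (x - y) + (φ x - φ y) • e := by
      rw [sub_smul]; abel
    rw [h]
    refine (norm_add_le _ _).trans ?_
    rw [norm_smul, H.norm_eq, mul_one, Real.norm_eq_abs]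
    have := H.abs_sub_le x y
    push_cast
    linarith
  have h := measure_image_le_of_lipschitz μ hL S
  rw [Measure.addHaar_submodule μ S hS, mul_zero] at h
  refine measure_mono_null (fun x hx => ?_) (le_antisymm h bot_le)
  have hx : φ x = inner ℝ e x := sub_eq_zero.1 hx
  refine ⟨x + (-inner ℝ e x) • e, ?_, ?_⟩
  · simp [S, inner_add_right, inner_smul_right, H.norm_eq]
  · dsimp only
    rw [H.invariant, hx, neg_smul, neg_add_cancel_right]

end IsGraphFunction

end VerticalShift

/-! ### Elementary inequalities for powers in `[0, ∞]`. -/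

section ENNRealInequalities

/-- Used with α the distance of two reflected points and β that of the original ones: singular
weights are moved to the reflected pair. -/
theorem div_rpow_le_mul_div_rpow {α β c : ℝ≥0∞} (h : α ≤ c * β) (hc0 : c ≠ 0) (hc : c ≠ ∞)
    {b : ℝ} (hb : 0 ≤ b) (X : ℝ≥0∞) : X / β ^ b ≤ c ^ b * (X / α ^ b) := by
  have h1 : α ^ b ≤ c ^ b * β ^ b := by
    rw [← ENNReal.mul_rpow_of_nonneg _ _ hb]
    exact ENNReal.rpow_le_rpow h hb
  have h0 : c ^ b ≠ 0 := by simp [ENNReal.rpow_eq_zero_iff, hc0, hc]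
  have h2 : c ^ b ≠ ∞ := ENNReal.rpow_ne_top_of_nonneg hb hc
  calc X / β ^ b = (c ^ b * X) / (c ^ b * β ^ b) := (ENNReal.mul_div_mul_left _ _ h0 h2).symm
    _ ≤ (c ^ b * X) / α ^ b := ENNReal.div_le_div_left h1 _
    _ = _ := by rw [mul_div_assoc]

theorem add_rpow_le_two {p : ℝ} (hp : 0 ≤ p) (a b : ℝ≥0∞) :
    (a + b) ^ p ≤ 2 ^ p * (a ^ p + b ^ p) := by
  rcases le_total a b with h | h
  · calc (a + b) ^ p ≤ (2 * b) ^ p := ENNReal.rpow_le_rpow (by rw [two_mul]; gcongr) hp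
      _ = 2 ^ p * b ^ p := ENNReal.mul_rpow_of_nonneg _ _ hp
      _ ≤ _ := by gcongr; exact le_add_self
  · calc (a + b) ^ p ≤ (2 * a) ^ p := ENNReal.rpow_le_rpow (by rw [two_mul]; gcongr) hp
      _ = 2 ^ p * a ^ p := ENNReal.mul_rpow_of_nonneg _ _ hp
      _ ≤ _ := by gcongr; exact le_self_add

theorem one_le_two_rpow {p : ℝ} (hp : 0 ≤ p) : (1 : ℝ≥0∞) ≤ 2 ^ p := by
  simpa using ENNReal.rpow_le_rpow (one_le_two : (1 : ℝ≥0∞) ≤ 2) hp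

theorem add_rpow_le_three {p : ℝ} (hp : 0 ≤ p) (a b c : ℝ≥0∞) :
    (a + b + c) ^ p ≤ 4 ^ p * (a ^ p + b ^ p + c ^ p) := by
  have h4 : (4 : ℝ≥0∞) ^ p = 2 ^ p * 2 ^ p := by
    rw [← ENNReal.mul_rpow_of_nonneg _ _ hp]; norm_num
  calc (a + b + c) ^ p ≤ 2 ^ p * ((a + b) ^ p + c ^ p) := add_rpow_le_two hp _ _
    _ ≤ 2 ^ p * (2 ^ p * (a ^ p + b ^ p) + 2 ^ p * c ^ p) := by
        gcongr
        · exact add_rpow_le_two hp _ _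
        · exact le_mul_of_one_le_left bot_le (one_le_two_rpow hp)
    _ = _ := by rw [h4]; ring

theorem add_rpow_le_four {p : ℝ} (hp : 0 ≤ p) (a b c d : ℝ≥0∞) :
    (a + b + c + d) ^ p ≤ 4 ^ p * (a ^ p + b ^ p + c ^ p + d ^ p) := by
  have h4 : (4 : ℝ≥0∞) ^ p = 2 ^ p * 2 ^ p := by
    rw [← ENNReal.mul_rpow_of_nonneg _ _ hp]; norm_num
  calc (a + b + c + d) ^ p = ((a + b) + (c + d)) ^ p := by rw [add_assoc]
    _ ≤ 2 ^ p * ((a + b) ^ p + (c + d) ^ p) := add_rpow_le_two hp _ _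
    _ ≤ 2 ^ p * (2 ^ p * (a ^ p + b ^ p) + 2 ^ p * (c ^ p + d ^ p)) := by
        gcongr <;> exact add_rpow_le_two hp _ _
    _ = _ := by rw [h4]; ring

theorem add_rpow_le_five {p : ℝ} (hp : 0 ≤ p) (a b c d f : ℝ≥0∞) :
    (a + b + c + d + f) ^ p ≤ 8 ^ p * (a ^ p + b ^ p + c ^ p + d ^ p + f ^ p) := by
  have h8 : (8 : ℝ≥0∞) ^ p = 2 ^ p * 4 ^ p := by
    rw [← ENNReal.mul_rpow_of_nonneg _ _ hp]; norm_num
  have h4 : (1 : ℝ≥0∞) ≤ 4 ^ p := by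
    simpa using ENNReal.rpow_le_rpow (by norm_num : (1 : ℝ≥0∞) ≤ 4) hp
  calc (a + b + c + d + f) ^ p ≤ 2 ^ p * ((a + b + c + d) ^ p + f ^ p) := add_rpow_le_two hp _ _
    _ ≤ 2 ^ p * (4 ^ p * (a ^ p + b ^ p + c ^ p + d ^ p) + 4 ^ p * f ^ p) := by
        gcongr
        · exact add_rpow_le_four hp _ _ _ _
        · exact le_mul_of_one_le_left bot_le h4
    _ = _ := by rw [h8]; ring

end ENNRealInequalities

/-! ### Algebraic identities for the projected difference. -/

section Kernels

variable {V : Type*} [NormedAddCommGroup V] [InnerProductSpace ℝ V]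

/-- The unnormalized projected difference `(u x - u y) · (x - y)`. -/
def projDiff (u : V → V) (x y : V) : ℝ := inner ℝ (u x - u y) (x - y)

/-- The kernel `|(u x - u y) · (x - y)|^p / |x - y|^b`. -/
noncomputable def projKernel (p b : ℝ) (u : V → V) (x y : V) : ℝ≥0∞ :=
  ‖projDiff u x y‖ₑ ^ p / ‖x - y‖ₑ ^ b

/-- The kernel `|u x - u y|^p / |x - y|^a`. -/
noncomputable def diffKernel (p a : ℝ) (u : V → V) (x y : V) : ℝ≥0∞ :=
  ‖u x - u y‖ₑ ^ p / ‖x - y‖ₑ ^ a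

theorem projDiff_comm (u : V → V) (x y : V) : projDiff u x y = projDiff u y x := by
  rw [projDiff, projDiff, ← neg_sub (u y), ← neg_sub y, inner_neg_neg]

theorem projKernel_comm (p b : ℝ) (u : V → V) (x y : V) :
    projKernel p b u x y = projKernel p b u y x := by
  rw [projKernel, projKernel, projDiff_comm, ← enorm_neg (x - y), neg_sub]

/-- In the parallelogram z, m + h, w, m - h the two sides issuing from a vertex add up to the
diagonal through it. Hence the coefficient of the value of `u` at each vertex agrees on both sides.
-/
theorem projDiff_parallelogram (u : V → V) (z w h : V) {m : V} (hm : z + w = m + m) :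
    projDiff u z w = projDiff u z (m + h) + projDiff u z (m - h) + projDiff u w (m + h)
      + projDiff u w (m - h) - projDiff u (m + h) (m - h) := by
  obtain rfl : w = m + m - z := by rw [← hm]; abel
  simp only [projDiff, inner_sub_left, inner_sub_right, inner_add_right]
  ring

theorem measurable_projKernel [FiniteDimensional ℝ V] [MeasurableSpace V] [BorelSpace V]
    (p b : ℝ) {u : V → V} (hu : Continuous u) :
    Measurable (Function.uncurry (projKernel p b u)) := by
  have h : Continuous fun z : V × V => projDiff u z.1 z.2 := by
    unfold projDiff; fun_prop
  have h' : Continuous fun z : V × V => z.1 - z.2 := by fun_prop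
  exact (h.measurable.enorm.pow_const p).div (h'.measurable.enorm.pow_const b)

theorem measurable_diffKernel [FiniteDimensional ℝ V] [MeasurableSpace V] [BorelSpace V]
    (p b : ℝ) {u : V → V} (hu : Continuous u) :
    Measurable (Function.uncurry (diffKernel p b u)) := by
  have h : Continuous fun z : V × V => u z.1 - u z.2 := by fun_prop
  have h' : Continuous fun z : V × V => z.1 - z.2 := by fun_prop
  exact (h.measurable.enorm.pow_const p).div (h'.measurable.enorm.pow_const b)

/-- The extension by the two reflections `vshift 2` and `vshift 3`, for fields vanishing on and
below the graph. -/
def extendField (e : V) (φ : V → ℝ) (u : V → V) (x : V) : V :=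
  u x + ((3 : ℝ) • u (vshift e φ 2 x) - (6 * inner ℝ e (u (vshift e φ 2 x))) • e)
    + ((-2 : ℝ) • u (vshift e φ 3 x) + (6 * inner ℝ e (u (vshift e φ 3 x))) • e)

namespace IsGraphFunction

variable {e : V} {φ : V → ℝ} {M : ℝ≥0} (H : IsGraphFunction e φ M) {u : V → V}
  (hu : ∀ x, 0 ≤ depth e φ x → u x = 0)
include H hu

theorem extendField_of_above {x : V} (hx : depth e φ x < 0) : extendField e φ u x = u x := by
  have h2 : u (vshift e φ 2 x) = 0 := hu _ (by rw [H.depth_vshift]; linarith)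
  have h3 : u (vshift e φ 3 x) = 0 := hu _ (by rw [H.depth_vshift]; linarith)
  simp [extendField, h2, h3]

omit H in
theorem extendField_of_below {x : V} (hx : 0 < depth e φ x) :
    extendField e φ u x = (3 : ℝ) • u (vshift e φ 2 x) - (6 * inner ℝ e (u (vshift e φ 2 x))) • e
    + ((-2 : ℝ) • u (vshift e φ 3 x) + (6 * inner ℝ e (u (vshift e φ 3 x))) • e) := by
  simp [extendField, hu x hx.le]

/-- The terms in `u y` collapse to the right one because 3 - 2 = 1 and 3 · 2 - 2 · 3 = 0, that is k
+ ℓ = 1 and k(1 + λ) + ℓ(1 + μ) = 0. -/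
theorem projDiff_extendField_cross {x y : V} (hx : 0 < depth e φ x) (hy : depth e φ y < 0) :
    projDiff (extendField e φ u) x y =
      3 * projDiff u (vshift e φ 2 x) y - 2 * projDiff u (vshift e φ 3 x) y
      - 6 * (inner ℝ e (u (vshift e φ 2 x)) - inner ℝ e (u (vshift e φ 3 x)))
        * (inner ℝ e (x - y) + depth e φ x) := by
  rw [projDiff, extendField_of_below hu hx, H.extendField_of_above hu hy, projDiff, projDiff]
  have h2 : vshift e φ 2 x - y = (x - y) + (2 * depth e φ x) • e := by simp only [vshift]; abel
  have h3 : vshift e φ 3 x - y = (x - y) + (3 * depth e φ x) • e := by simp only [vshift]; abel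
  rw [h2, h3]
  generalize u (vshift e φ 2 x) = a
  generalize u (vshift e φ 3 x) = b
  generalize x - y = v
  simp only [inner_add_left, inner_sub_left, inner_add_right, inner_sub_right, inner_smul_left,
    inner_smul_right, real_inner_comm e, RCLike.conj_to_real]
  ring

-- The reflected increment of parameter t is x - y plus t times the depth increment along `e`. Its
-- part coming from x - y alone reproduces the coefficients -3 and 4 of the vertical component; its
-- part coming from `φ x - φ y` is the error.
omit H in
theorem projDiff_extendField_below {x y : V} (hx : 0 < depth e φ x)
    (hy : 0 < depth e φ y) :
    projDiff (extendField e φ u) x y =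
      3 * projDiff u (vshift e φ 2 x) (vshift e φ 2 y)
      - 2 * projDiff u (vshift e φ 3 x) (vshift e φ 3 y)
      - 6 * (φ x - φ y) * inner ℝ e (u (vshift e φ 2 x) - u (vshift e φ 2 y))
      + 6 * (φ x - φ y) * inner ℝ e (u (vshift e φ 3 x) - u (vshift e φ 3 y)) := by
  rw [projDiff, extendField_of_below hu hx, extendField_of_below hu hy, projDiff, projDiff]
  have h (t : ℝ) : vshift e φ t x - vshift e φ t y
      = (x - y) + (t * ((φ x - φ y) - inner ℝ e (x - y))) • e := by
    have : depth e φ x - depth e φ y = (φ x - φ y) - inner ℝ e (x - y) := by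
      simp only [depth, inner_sub_right]; ring
    rw [← this]
    simp only [vshift, mul_sub, sub_smul]; abel
  rw [h, h]
  generalize u (vshift e φ 2 x) = a
  generalize u (vshift e φ 3 x) = b
  generalize u (vshift e φ 2 y) = a'
  generalize u (vshift e φ 3 y) = b'
  generalize x - y = v
  simp only [inner_add_left, inner_sub_left, inner_add_right, inner_sub_right, inner_smul_left,
    inner_smul_right, real_inner_comm e, RCLike.conj_to_real]
  ring

end IsGraphFunction

end Kernels

theorem enorm_le_mul_enorm_of_norm_le {V W : Type*} [SeminormedAddCommGroup V]
    [SeminormedAddCommGroup W] {a : V} {b : W} {c : ℝ≥0} (h : ‖a‖ ≤ c * ‖b‖) :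
    ‖a‖ₑ ≤ c * ‖b‖ₑ := by
  have : ‖a‖₊ ≤ c * ‖b‖₊ := h
  simp only [enorm_eq_nnnorm]
  exact_mod_cast this

theorem enorm_mul_le_of_abs_le {V : Type*} [SeminormedAddCommGroup V] (c t s : ℝ) {M : ℝ≥0∞}
    {v : V} {w : ℝ≥0∞} (ht : ‖t‖ₑ ≤ M * w) (hs : ‖s‖ₑ ≤ ‖v‖ₑ) :
    ‖c * t * s‖ₑ ≤ ‖c‖ₑ * (M * ‖v‖ₑ * w) := by
  rw [enorm_mul, enorm_mul, mul_assoc]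
  gcongr ‖c‖ₑ * ?_
  calc _ ≤ M * w * ‖v‖ₑ := mul_le_mul' ht hs
    _ = _ := by ring

/-- A factor |x - y| gained in an error term lowers the exponent a + p of the projected kernel to
the exponent a of the Gagliardo kernel. At `w = 0` the left side is 0, so only an inequality holds.
-/
theorem mul_rpow_div_rpow_add_le {w X : ℝ≥0∞} {p a : ℝ} (hp : 0 < p) (hw : w ≠ ∞) :
    X * w ^ p / w ^ (a + p) ≤ X / w ^ a := by
  rcases eq_or_ne w 0 with rfl | h0
  · simp [ENNReal.zero_rpow_of_pos hp]
  · rw [ENNReal.rpow_add _ _ h0 hw, ENNReal.mul_div_mul_right]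
    · simp [ENNReal.rpow_eq_zero_iff, h0, hw]
    · exact ENNReal.rpow_ne_top_of_nonneg hp.le hw

theorem enorm_ofNat_real (k : ℕ) [k.AtLeastTwo] : ‖(OfNat.ofNat k : ℝ)‖ₑ = OfNat.ofNat k := by
  rw [← ofReal_norm, Real.norm_of_nonneg (Nat.ofNat_nonneg k), ENNReal.ofReal_ofNat]

/-! ### Pointwise kernel estimates. -/

section Pointwise

variable {V : Type*} [NormedAddCommGroup V] [InnerProductSpace ℝ V]

theorem projKernel_le_of_norm_le {p b : ℝ} (hb : 0 ≤ b) (u : V → V) {x y x' y' : V}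
    (h : ‖x' - y'‖ ≤ 7 * ‖x - y‖) :
    ‖projDiff u x' y'‖ₑ ^ p / ‖x - y‖ₑ ^ b ≤ 7 ^ b * projKernel p b u x' y' :=
  div_rpow_le_mul_div_rpow (enorm_le_mul_enorm_of_norm_le (c := 7) h) (by simp) (by simp) hb _

omit [InnerProductSpace ℝ V] in
theorem diffKernel_le_of_norm_le {p a : ℝ} (ha : 0 ≤ a) (u : V → V) {x y x' y' : V}
    (h : ‖x' - y'‖ ≤ 7 * ‖x - y‖) :
    ‖u x' - u y'‖ₑ ^ p / ‖x - y‖ₑ ^ a ≤ 7 ^ a * diffKernel p a u x' y' :=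
  div_rpow_le_mul_div_rpow (enorm_le_mul_enorm_of_norm_le (c := 7) h) (by simp) (by simp) ha _

namespace IsGraphFunction

variable {e : V} {φ : V → ℝ} {M : ℝ≥0} (H : IsGraphFunction e φ M) {u : V → V}
include H

theorem enorm_inner_le (v : V) : ‖inner ℝ e v‖ₑ ≤ ‖v‖ₑ := by
  simpa using enorm_le_mul_enorm_of_norm_le (c := 1) (by simpa using H.abs_inner_le v)

theorem projKernel_extendField_below_le (hu : ∀ x, 0 ≤ depth e φ x → u x = 0) {p a : ℝ}
    (hp : 0 < p) (ha : 0 ≤ a) {x y : V} (hx : 0 < depth e φ x) (hy : 0 < depth e φ y) :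
    projKernel p (a + p) (extendField e φ u) x y ≤ 24 ^ p * 7 ^ (a + p) *
      (projKernel p (a + p) u (vshift e φ 2 x) (vshift e φ 2 y)
      + projKernel p (a + p) u (vshift e φ 3 x) (vshift e φ 3 y)
      + M ^ p * diffKernel p a u (vshift e φ 2 x) (vshift e φ 2 y)
      + M ^ p * diffKernel p a u (vshift e φ 3 x) (vshift e φ 3 y)) := by
  have hb : 0 ≤ a + p := by positivity
  have n2 := H.norm_vshift_sub_le (t := 2) (by norm_num) x y
  have n3 := H.norm_vshift_sub_le (t := 3) (by norm_num) x y
  have hφ : ‖φ x - φ y‖ₑ ≤ M * ‖x - y‖ₑ := enorm_le_mul_enorm_of_norm_le (H.abs_sub_le x y)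
  have hQ : ‖projDiff (extendField e φ u) x y‖ₑ ≤
      6 * (‖projDiff u (vshift e φ 2 x) (vshift e φ 2 y)‖ₑ
      + ‖projDiff u (vshift e φ 3 x) (vshift e φ 3 y)‖ₑ
      + M * ‖u (vshift e φ 2 x) - u (vshift e φ 2 y)‖ₑ * ‖x - y‖ₑ
      + M * ‖u (vshift e φ 3 x) - u (vshift e φ 3 y)‖ₑ * ‖x - y‖ₑ) := by
    rw [projDiff_extendField_below hu hx hy]
    refine (enorm_add_le _ _).trans ?_
    simp only [mul_add]
    gcongr ?_ + ?_
    · refine (enorm_sub_le).trans ?_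
      gcongr ?_ + ?_
      · refine (enorm_sub_le).trans ?_
        gcongr ?_ + ?_
        · rw [enorm_mul, enorm_ofNat_real]; gcongr; norm_num
        · rw [enorm_mul, enorm_ofNat_real]; gcongr; norm_num
      · rw [← enorm_ofNat_real 6]
        exact enorm_mul_le_of_abs_le _ _ _ hφ (H.enorm_inner_le _)
    · rw [← enorm_ofNat_real 6]
      exact enorm_mul_le_of_abs_le _ _ _ hφ (H.enorm_inner_le _)
  have hQp := (ENNReal.rpow_le_rpow hQ hp.le)
  rw [ENNReal.mul_rpow_of_nonneg _ _ hp.le] at hQp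
  replace hQp := hQp.trans (mul_le_mul_right (add_rpow_le_four hp.le _ _ _ _) _)
  have h24 : (24 : ℝ≥0∞) ^ p = 6 ^ p * 4 ^ p := by
    rw [← ENNReal.mul_rpow_of_nonneg _ _ hp.le]; norm_num
  rw [← mul_assoc, ← h24] at hQp
  rw [projKernel]
  refine (ENNReal.div_le_div_right hQp _).trans ?_
  have h7 : (7 : ℝ≥0∞) ^ a ≤ 7 ^ (a + p) :=
    ENNReal.rpow_le_rpow_of_exponent_le (by norm_num) (by linarith)
  have hd (t : ℝ) (ht : ‖vshift e φ t x - vshift e φ t y‖ ≤ 7 * ‖x - y‖) :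
      (M * ‖u (vshift e φ t x) - u (vshift e φ t y)‖ₑ * ‖x - y‖ₑ) ^ p / ‖x - y‖ₑ ^ (a + p)
      ≤ 7 ^ (a + p) * (M ^ p * diffKernel p a u (vshift e φ t x) (vshift e φ t y)) := by
    rw [ENNReal.mul_rpow_of_nonneg _ _ hp.le, ENNReal.mul_rpow_of_nonneg _ _ hp.le]
    refine (mul_rpow_div_rpow_add_le hp (by simp)).trans ?_
    rw [mul_div_assoc, mul_left_comm]
    gcongr
    exact (diffKernel_le_of_norm_le ha u ht).trans (by gcongr)
  rw [mul_div_assoc, mul_assoc (24 ^ p) (7 ^ (a + p))]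
  gcongr 24 ^ p * ?_
  simp only [ENNReal.add_div, mul_add]
  gcongr ?_ + ?_ + ?_ + ?_
  · exact projKernel_le_of_norm_le hb u n2
  · exact projKernel_le_of_norm_le hb u n3
  · exact hd 2 n2
  · exact hd 3 n3

/-- For x below and y above, depth(x) ≤ 2|x - y|. This bounds both the distances from y to the
reflected points and the geometric factor in front of Δ; the latter supplies the |x - y| that lowers
the exponent to a. -/
theorem projKernel_extendField_cross_le (hu : ∀ x, 0 ≤ depth e φ x → u x = 0) {p a : ℝ}
    (hp : 0 < p) (ha : 0 ≤ a) {x y : V} (hx : 0 < depth e φ x) (hy : depth e φ y < 0) :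
    projKernel p (a + p) (extendField e φ u) x y ≤ 72 ^ p * 7 ^ (a + p) *
      (projKernel p (a + p) u (vshift e φ 2 x) y + projKernel p (a + p) u (vshift e φ 3 x) y
      + ‖inner ℝ e (u (vshift e φ 2 x)) - inner ℝ e (u (vshift e φ 3 x))‖ₑ ^ p
        / ‖x - y‖ₑ ^ a) := by
  have hb : 0 ≤ a + p := by positivity
  have n2 := H.norm_vshift_sub_le_of_depth (t := 2) (by norm_num) hx hy
  have n3 := H.norm_vshift_sub_le_of_depth (t := 3) (by norm_num) hx hy
  set Δ := inner ℝ e (u (vshift e φ 2 x)) - inner ℝ e (u (vshift e φ 3 x)) with hΔ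
  have hv : ‖inner ℝ e (x - y) + depth e φ x‖ₑ ≤ 3 * ‖x - y‖ₑ := by
    refine enorm_le_mul_enorm_of_norm_le (c := 3) ?_
    refine (norm_add_le _ _).trans ?_
    have h1 := H.abs_inner_le (x - y)
    have h2 := H.depth_le (x := x) hy
    rw [Real.norm_eq_abs, Real.norm_eq_abs, abs_of_pos hx]
    push_cast; linarith
  have hQ : ‖projDiff (extendField e φ u) x y‖ₑ ≤
      18 * (‖projDiff u (vshift e φ 2 x) y‖ₑ + ‖projDiff u (vshift e φ 3 x) y‖ₑ
      + ‖Δ‖ₑ * ‖x - y‖ₑ) := by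
    rw [H.projDiff_extendField_cross hu hx hy, ← hΔ]
    refine (enorm_sub_le).trans ?_
    rw [mul_add (18 : ℝ≥0∞), mul_add (18 : ℝ≥0∞)]
    gcongr ?_ + ?_
    · refine (enorm_sub_le).trans ?_
      gcongr ?_ + ?_
      · rw [enorm_mul, enorm_ofNat_real]; gcongr; norm_num
      · rw [enorm_mul, enorm_ofNat_real]; gcongr; norm_num
    · rw [enorm_mul, enorm_mul, enorm_ofNat_real]
      calc _ ≤ 6 * ‖Δ‖ₑ * (3 * ‖x - y‖ₑ) := by gcongr
        _ = (6 * 3) * (‖Δ‖ₑ * ‖x - y‖ₑ) := by ring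
        _ ≤ _ := by norm_num
  have hQp := (ENNReal.rpow_le_rpow hQ hp.le)
  rw [ENNReal.mul_rpow_of_nonneg _ _ hp.le] at hQp
  replace hQp := hQp.trans (mul_le_mul_right (add_rpow_le_three hp.le _ _ _) _)
  have h72 : (72 : ℝ≥0∞) ^ p = 18 ^ p * 4 ^ p := by
    rw [← ENNReal.mul_rpow_of_nonneg _ _ hp.le]; norm_num
  rw [← mul_assoc, ← h72] at hQp
  rw [projKernel]
  refine (ENNReal.div_le_div_right hQp _).trans ?_
  rw [mul_div_assoc, mul_assoc (72 ^ p) (7 ^ (a + p))]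
  gcongr 72 ^ p * ?_
  simp only [ENNReal.add_div, mul_add]
  gcongr ?_ + ?_ + ?_
  · exact projKernel_le_of_norm_le hb u n2
  · exact projKernel_le_of_norm_le hb u n3
  · rw [ENNReal.mul_rpow_of_nonneg _ _ hp.le]
    refine (mul_rpow_div_rpow_add_le hp (by simp)).trans ?_
    refine le_mul_of_one_le_left bot_le ?_
    simpa using ENNReal.rpow_le_rpow (by norm_num : (1 : ℝ≥0∞) ≤ 7) hb

/-- The difference of the vertical components at two points of a vertical line is controlled by
projected differences along the sides and a diagonal of a parallelogram. -/
theorem vertical_diff_le {p a : ℝ} (hp : 0 < p) (ha : 0 ≤ a) {x h : V} (hx : 0 < depth e φ x)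
    (hh : ‖h‖ < depth e φ x / 2) :
    ‖inner ℝ e (u (vshift e φ 2 x)) - inner ℝ e (u (vshift e φ 3 x))‖ₑ ^ p
        / ENNReal.ofReal (depth e φ x) ^ a ≤ 8 ^ p *
      (projKernel p (a + p) u (vshift e φ 2 x) (vshift e φ (5 / 2) x + h)
      + projKernel p (a + p) u (vshift e φ 2 x) (vshift e φ (5 / 2) x - h)
      + projKernel p (a + p) u (vshift e φ 3 x) (vshift e φ (5 / 2) x + h)
      + projKernel p (a + p) u (vshift e φ 3 x) (vshift e φ (5 / 2) x - h)
      + projKernel p (a + p) u (vshift e φ (5 / 2) x + h) (vshift e φ (5 / 2) x - h)) := by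
  have hb : 0 ≤ a + p := by positivity
  set r := depth e φ x with hr
  have hR : ‖r‖ₑ = ENNReal.ofReal r := by rw [← ofReal_norm, Real.norm_of_nonneg hx.le]
  have hR0 : ENNReal.ofReal r ≠ 0 := by simpa using hx
  have hpar := projDiff_parallelogram u (vshift e φ 2 x) (vshift e φ 3 x) h
    (m := vshift e φ (5 / 2) x) (by simp only [vshift]; module)
  -- The two reflected points differ by a vertical vector of length r, so here the projection sees
  -- exactly the vertical component.
  have hzw : projDiff u (vshift e φ 2 x) (vshift e φ 3 x)
      = -((inner ℝ e (u (vshift e φ 2 x)) - inner ℝ e (u (vshift e φ 3 x))) * r) := by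
    have : vshift e φ 2 x - vshift e φ 3 x = (-r) • e := by simp only [vshift, ← hr]; module
    rw [projDiff, this, inner_smul_right, real_inner_comm, inner_sub_right]; ring
  set Δ := inner ℝ e (u (vshift e φ 2 x)) - inner ℝ e (u (vshift e φ 3 x))
  have hΔ : ‖Δ‖ₑ * ENNReal.ofReal r = ‖projDiff u (vshift e φ 2 x) (vshift e φ 3 x)‖ₑ := by
    rw [hzw, enorm_neg, enorm_mul, hR]
  -- Sides and second diagonal have length at most r, so replacing r by the true distance only
  -- enlarges each quotient.
  have hdist {v w : V} (hvw : ‖v - w‖ ≤ r) :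
      ‖projDiff u v w‖ₑ ^ p / ENNReal.ofReal r ^ (a + p) ≤ projKernel p (a + p) u v w := by
    refine ENNReal.div_le_div_left (ENNReal.rpow_le_rpow ?_ hb) _
    rw [← ofReal_norm]; exact ENNReal.ofReal_le_ofReal hvw
  have hshift (c : ℝ) (g : V) (hc : |c| ≤ 1 / 2) (hg : ‖g‖ < r / 2) : ‖(c * r) • e + g‖ ≤ r := by
    refine (norm_add_le _ _).trans ?_
    rw [norm_smul, H.norm_eq, mul_one, Real.norm_eq_abs, abs_mul, abs_of_pos hx]
    have := mul_le_mul_of_nonneg_right hc hx.le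
    linarith
  have hh' : ‖-h‖ < r / 2 := by rwa [norm_neg]
  have hle : ‖Δ‖ₑ ^ p / ENNReal.ofReal r ^ a
      = ‖projDiff u (vshift e φ 2 x) (vshift e φ 3 x)‖ₑ ^ p / ENNReal.ofReal r ^ (a + p) := by
    rw [← hΔ, ENNReal.mul_rpow_of_nonneg _ _ hp.le, ENNReal.rpow_add _ _ hR0 (by simp),
      ENNReal.mul_div_mul_right]
    · simp [ENNReal.rpow_eq_zero_iff, hx]
    · exact ENNReal.rpow_ne_top_of_nonneg hp.le (by simp)
  rw [hle, hpar]
  have hsum : ∀ q₁ q₂ q₃ q₄ q₅ : ℝ, ‖q₁ + q₂ + q₃ + q₄ - q₅‖ₑ ^ p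
      ≤ 8 ^ p * (‖q₁‖ₑ ^ p + ‖q₂‖ₑ ^ p + ‖q₃‖ₑ ^ p + ‖q₄‖ₑ ^ p + ‖q₅‖ₑ ^ p) := by
    intro q₁ q₂ q₃ q₄ q₅
    refine (ENNReal.rpow_le_rpow ?_ hp.le).trans (add_rpow_le_five hp.le _ _ _ _ _)
    refine (enorm_sub_le).trans ?_
    gcongr
    refine (enorm_add_le _ _).trans ?_
    gcongr
    refine (enorm_add_le _ _).trans ?_
    gcongr
    exact enorm_add_le _ _
  refine (ENNReal.div_le_div_right (hsum _ _ _ _ _) _).trans ?_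
  rw [mul_div_assoc]
  gcongr 8 ^ p * ?_
  simp only [ENNReal.add_div]
  gcongr ?_ + ?_ + ?_ + ?_ + ?_
  · refine hdist ?_
    convert hshift (-1 / 2) (-h) (by norm_num [abs_le]) hh' using 2
    simp only [vshift, ← hr]; module
  · refine hdist ?_
    convert hshift (-1 / 2) h (by norm_num [abs_le]) hh using 2
    simp only [vshift, ← hr]; module
  · refine hdist ?_
    convert hshift (1 / 2) (-h) (by norm_num [abs_le]) hh' using 2
    simp only [vshift, ← hr]; module
  · refine hdist ?_
    convert hshift (1 / 2) h (by norm_num [abs_le]) hh using 2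
    simp only [vshift, ← hr]; module
  · refine hdist ?_
    have : vshift e φ (5 / 2) x + h - (vshift e φ (5 / 2) x - h) = h + h := by abel
    rw [this]
    exact (norm_add_le _ _).trans (by linarith)

end IsGraphFunction

end Pointwise

/-! ### Tail integral of the singular weight. -/

section Tail

variable {V : Type*} [NormedAddCommGroup V] [NormedSpace ℝ V] [FiniteDimensional ℝ V]
  [MeasurableSpace V] [BorelSpace V] (μ : Measure V) [μ.IsAddHaarMeasure]

theorem lintegral_comp_inv_smul {F : V → ℝ≥0∞} (hF : Measurable F) {r : ℝ} (hr : 0 < r) :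
    ∫⁻ y, F (r⁻¹ • y) ∂μ = ENNReal.ofReal r ^ Module.finrank ℝ V * ∫⁻ y, F y ∂μ := by
  rw [← lintegral_map hF (measurable_const_smul r⁻¹),
    Measure.map_addHaar_smul μ (inv_ne_zero hr.ne'), lintegral_smul_measure, smul_eq_mul,
    inv_pow, inv_inv, abs_of_pos (pow_pos hr _), ENNReal.ofReal_pow hr.le]

/-- The integral of `|x - y|^{-d-σ}` outside the ball of radius `r / 2` is at most `C r^{-σ}`. -/
theorem exists_lintegral_tail_le {σ : ℝ} (hσ : 0 < σ) :
    ∃ C : ℝ≥0∞, C ≠ ∞ ∧ ∀ (x : V) (r : ℝ), 0 < r →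
      ∫⁻ y in {y | r ≤ 2 * ‖x - y‖}, 1 / ‖x - y‖ₑ ^ (Module.finrank ℝ V + σ) ∂μ
        ≤ C / ENNReal.ofReal r ^ σ := by
  set d := Module.finrank ℝ V
  set a : ℝ := d + σ with ha
  have ha0 : 0 < a := by positivity
  set G : V → ℝ≥0∞ := fun y => ENNReal.ofReal ((1 + ‖y‖) ^ (-a)) with hG
  have hGm : Measurable G := by fun_prop
  have hfin : ∫⁻ y, G y ∂μ < ∞ := finite_integral_one_add_norm (by rw [ha]; linarith)
  refine ⟨3 ^ a * ∫⁻ y, G y ∂μ, ENNReal.mul_ne_top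
    (ENNReal.rpow_ne_top_of_nonneg ha0.le (by simp)) hfin.ne, fun x r hr => ?_⟩
  have hR0 : ENNReal.ofReal r ≠ 0 := by simpa using hr
  have hRt : ENNReal.ofReal r ≠ ∞ := by simp
  have hS : MeasurableSet {y : V | r ≤ 2 * ‖x - y‖} :=
    (isClosed_le (by fun_prop) (by fun_prop)).measurableSet
  have hpt : ∀ y ∈ {y : V | r ≤ 2 * ‖x - y‖}, 1 / ‖x - y‖ₑ ^ a
      ≤ 3 ^ a / ENNReal.ofReal r ^ a * G (r⁻¹ • (x - y)) := by
    intro y hy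
    have hy : r ≤ 2 * ‖x - y‖ := hy
    have hpos : 0 < ‖x - y‖ := by linarith
    -- Since r ≤ 2|x - y|, also r + |x - y| ≤ 3|x - y|. This dominates the singular weight by a
    -- rescaled copy of an integrable function.
    have h1 : ENNReal.ofReal (1 + ‖r⁻¹ • (x - y)‖) * ENNReal.ofReal r ≤ 3 * ‖x - y‖ₑ := by
      rw [← ENNReal.ofReal_mul (by positivity), ← ofReal_norm, ← ENNReal.ofReal_ofNat,
        ← ENNReal.ofReal_mul (by positivity)]
      refine ENNReal.ofReal_le_ofReal ?_
      rw [norm_smul, norm_inv, Real.norm_of_nonneg hr.le, add_mul, mul_right_comm,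
        inv_mul_cancel₀ hr.ne']
      linarith
    have h2 := div_rpow_le_mul_div_rpow h1 (by simp) (by simp) ha0.le 1
    refine h2.trans (le_of_eq ?_)
    rw [hG, ENNReal.mul_rpow_of_nonneg _ _ ha0.le]
    dsimp only
    rw [Real.rpow_neg (by positivity), ENNReal.ofReal_inv_of_pos (by positivity),
      ← ENNReal.ofReal_rpow_of_nonneg (by positivity) ha0.le, one_div, div_eq_mul_inv, mul_assoc,
      ENNReal.mul_inv, mul_comm (ENNReal.ofReal r ^ a)⁻¹]
    · right; exact ENNReal.rpow_ne_top_of_nonneg ha0.le hRt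
    · left; exact ENNReal.rpow_ne_top_of_nonneg ha0.le (by simp)
  calc _ ≤ ∫⁻ y in {y | r ≤ 2 * ‖x - y‖},
        3 ^ a / ENNReal.ofReal r ^ a * G (r⁻¹ • (x - y)) ∂μ := setLIntegral_mono' hS hpt
    _ ≤ ∫⁻ y, 3 ^ a / ENNReal.ofReal r ^ a * G (r⁻¹ • (x - y)) ∂μ :=
        setLIntegral_le_lintegral _ _
    _ = 3 ^ a / ENNReal.ofReal r ^ a * (ENNReal.ofReal r ^ d * ∫⁻ y, G y ∂μ) := by
        rw [lintegral_const_mul _ (by fun_prop),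
          lintegral_sub_left_eq_self (fun y => G (r⁻¹ • y)) x, lintegral_comp_inv_smul μ hGm hr]
    _ = _ := by
        rw [ha, ENNReal.rpow_add _ _ hR0 hRt, ENNReal.rpow_natCast, div_eq_mul_inv, div_eq_mul_inv,
          ENNReal.mul_inv (Or.inr (ENNReal.rpow_ne_top_of_nonneg hσ.le hRt))
            (Or.inl (ENNReal.pow_ne_top hRt))]
        calc _ = (ENNReal.ofReal r ^ d)⁻¹ * ENNReal.ofReal r ^ d *
              (3 ^ (d + σ) * (∫⁻ y, G y ∂μ) * (ENNReal.ofReal r ^ σ)⁻¹) := by ring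
          _ = _ := by
            rw [ENNReal.inv_mul_cancel (pow_ne_zero _ hR0) (ENNReal.pow_ne_top hRt), one_mul]

end Tail

/-! ### Kernels cut off outside a set. -/

section RestrictedKernels

variable {V : Type*}

/-- The kernel `F`, set to zero unless both points lie in `D`. -/
noncomputable def restrictKernel (D : Set V) (F : V → V → ℝ≥0∞) (x y : V) : ℝ≥0∞ :=
  (D ×ˢ D).indicator (Function.uncurry F) (x, y)

theorem restrictKernel_of_mem {D : Set V} {F : V → V → ℝ≥0∞} {x y : V} (hx : x ∈ D)
    (hy : y ∈ D) : restrictKernel D F x y = F x y := by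
  rw [restrictKernel, indicator_of_mem (mk_mem_prod hx hy)]; rfl

variable [MeasurableSpace V]

theorem measurable_restrictKernel {D : Set V} (hD : MeasurableSet D) {F : V → V → ℝ≥0∞}
    (hF : Measurable (Function.uncurry F)) :
    Measurable (Function.uncurry (restrictKernel D F)) :=
  hF.indicator (hD.prod hD)

variable (μ : Measure V)

theorem lintegral_restrictKernel {D : Set V} (hD : MeasurableSet D) (F : V → V → ℝ≥0∞) :
    ∫⁻ x, ∫⁻ y, restrictKernel D F x y ∂μ ∂μ = ∫⁻ x in D, ∫⁻ y in D, F x y ∂μ ∂μ := by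
  rw [← lintegral_indicator hD]
  refine lintegral_congr fun x => ?_
  by_cases hx : x ∈ D
  · rw [indicator_of_mem hx, ← lintegral_indicator hD]
    refine lintegral_congr fun y => ?_
    by_cases hy : y ∈ D
    · rw [indicator_of_mem hy, restrictKernel_of_mem hx hy]
    · rw [indicator_of_notMem hy, restrictKernel, indicator_of_notMem fun h => hy h.2]
  · rw [indicator_of_notMem hx]
    simp [restrictKernel, hx]

theorem lintegral_lintegral_add [SFinite μ] {A B : V → V → ℝ≥0∞}
    (hA : Measurable (Function.uncurry A)) :
    ∫⁻ x, ∫⁻ y, (A x y + B x y) ∂μ ∂μ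
      = ∫⁻ x, ∫⁻ y, A x y ∂μ ∂μ + ∫⁻ x, ∫⁻ y, B x y ∂μ ∂μ := by
  have h : Measurable fun x => ∫⁻ y, A x y ∂μ := hA.lintegral_prod_right'
  rw [← lintegral_add_left h]
  exact lintegral_congr fun x => lintegral_add_left hA.of_uncurry_left _

end RestrictedKernels

/-! ### Substitutions in double integrals. -/

section DoubleIntegrals

variable {V : Type*} [NormedAddCommGroup V] [InnerProductSpace ℝ V] [FiniteDimensional ℝ V]
  [MeasurableSpace V] [BorelSpace V] (μ : Measure V) [μ.IsAddHaarMeasure]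
  {K : V → V → ℝ≥0∞} (hK : Measurable (Function.uncurry K))
include hK

/-- Substitution of sum and difference in a double integral. -/
theorem lintegral_add_sub_le :
    ∫⁻ z, ∫⁻ h, K (z + h) (z - h) ∂μ ∂μ ≤ ∫⁻ x, ∫⁻ y, K x y ∂μ ∂μ := by
  have h1 : ∀ z, ∫⁻ h, K (z + h) (z - h) ∂μ = ∫⁻ h, K h ((2 : ℝ) • z - h) ∂μ := fun z => by
    rw [← lintegral_add_left_eq_self (fun h => K h ((2 : ℝ) • z - h)) z]
    refine lintegral_congr fun h => ?_
    congr 1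
    module
  simp only [h1]
  have h2 : Measurable (Function.uncurry fun z h => K h ((2 : ℝ) • z - h)) :=
    hK.comp (f := fun q : V × V => (q.2, (2 : ℝ) • q.1 - q.2)) (by fun_prop)
  rw [lintegral_lintegral_swap h2.aemeasurable]
  refine lintegral_mono fun y => ?_
  have hm : Measurable fun z => K y (z - y) :=
    hK.comp (f := fun z : V => (y, z - y)) (by fun_prop)
  -- Halving is a left inverse of doubling; treating it as merely 1-Lipschitz gives the constant 1,
  -- which suffices.
  have h3 := lintegral_comp_le_of_leftInverse μ (K := 1) (g := fun z => (2⁻¹ : ℝ) • z)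
    (h := fun z => (2 : ℝ) • z) ((lipschitzWith_smul (2⁻¹ : ℝ)).weaken ?_)
    (fun z => by simp) (by fun_prop) hm
  · rw [lintegral_sub_right_eq_self (fun z => K y z) y] at h3
    simpa using h3
  · rw [← NNReal.coe_le_coe]; norm_num

namespace IsGraphFunction

variable {e : V} {φ : V → ℝ} {M : ℝ≥0} (H : IsGraphFunction e φ M)
include H

theorem lintegral_comp_vshift_left_le {s t : ℝ} (hs : |s| ≤ 3) (hst : t + s * (1 - t) = 0) :
    ∫⁻ x, ∫⁻ y, K (vshift e φ t x) y ∂μ ∂μ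
      ≤ 7 ^ Module.finrank ℝ V * ∫⁻ x, ∫⁻ y, K x y ∂μ ∂μ :=
  H.lintegral_comp_vshift_le μ hs hst hK.lintegral_prod_right'

theorem lintegral_comp_vshift_both_le {s t : ℝ} (hs : |s| ≤ 3) (hst : t + s * (1 - t) = 0) :
    ∫⁻ x, ∫⁻ y, K (vshift e φ t x) (vshift e φ t y) ∂μ ∂μ
      ≤ 7 ^ Module.finrank ℝ V * 7 ^ Module.finrank ℝ V * ∫⁻ x, ∫⁻ y, K x y ∂μ ∂μ := by
  calc _ ≤ ∫⁻ x, 7 ^ Module.finrank ℝ V * ∫⁻ y, K (vshift e φ t x) y ∂μ ∂μ :=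
        lintegral_mono fun x => H.lintegral_comp_vshift_le μ hs hst hK.of_uncurry_left
    _ = 7 ^ Module.finrank ℝ V * ∫⁻ x, ∫⁻ y, K (vshift e φ t x) y ∂μ ∂μ :=
        lintegral_const_mul _ (hK.lintegral_prod_right'.comp (H.continuous_vshift t).measurable)
    _ ≤ _ := by
        rw [mul_assoc]
        gcongr
        exact H.lintegral_comp_vshift_left_le μ hK hs hst

theorem lintegral_add_sub_vshift_le {s t : ℝ} (hs : |s| ≤ 3) (hst : t + s * (1 - t) = 0) :
    ∫⁻ x, ∫⁻ h, K (vshift e φ t x + h) (vshift e φ t x - h) ∂μ ∂μ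
      ≤ 7 ^ Module.finrank ℝ V * ∫⁻ x, ∫⁻ y, K x y ∂μ ∂μ := by
  have hm : Measurable (Function.uncurry fun z h => K (z + h) (z - h)) :=
    hK.comp (f := fun q : V × V => (q.1 + q.2, q.1 - q.2)) (by fun_prop)
  refine (H.lintegral_comp_vshift_left_le μ hm hs hst).trans ?_
  exact mul_le_mul_right (lintegral_add_sub_le μ hK) _

end IsGraphFunction

end DoubleIntegrals

/-! ### The two sides of the graph. -/

section Regions

variable {V : Type*} [NormedAddCommGroup V] [InnerProductSpace ℝ V]

/-- The region strictly above the graph. -/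
def above (e : V) (φ : V → ℝ) : Set V := {x | depth e φ x < 0}

/-- The region strictly below the graph. -/
def below (e : V) (φ : V → ℝ) : Set V := {x | 0 < depth e φ x}

namespace IsGraphFunction

variable {e : V} {φ : V → ℝ} {M : ℝ≥0} (H : IsGraphFunction e φ M)
include H

theorem continuous_extendField {u : V → V} (hu : Continuous u) :
    Continuous (extendField e φ u) := by
  have h2 := H.continuous_vshift 2
  have h3 := H.continuous_vshift 3
  unfold extendField
  fun_prop

theorem vshift_mem_above {t : ℝ} (ht : 1 < t) {x : V} (hx : x ∈ below e φ) :
    vshift e φ t x ∈ above e φ := by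
  have hx : 0 < depth e φ x := hx
  change depth e φ _ < 0
  rw [H.depth_vshift]
  exact mul_neg_of_neg_of_pos (by linarith) hx

/-- The midpoint has depth -3/2 times that of `x`, and a displacement shorter than half the depth of
`x` changes this by less than one depth. So the whole parallelogram has its vertices above the
graph. -/
theorem vshift_add_mem_above {x h : V} (hx : x ∈ below e φ) (hh : ‖h‖ < depth e φ x / 2) :
    vshift e φ (5 / 2) x + h ∈ above e φ := by
  have hx : 0 < depth e φ x := hx
  have h1 := (le_abs_self _).trans
    (H.abs_depth_sub_le (vshift e φ (5 / 2) x + h) (vshift e φ (5 / 2) x))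
  rw [add_sub_cancel_left, H.depth_vshift] at h1
  change depth e φ _ < 0
  linarith

variable [MeasurableSpace V] [BorelSpace V]

theorem measurableSet_above : MeasurableSet (above e φ) :=
  (isOpen_lt H.continuous_depth continuous_const).measurableSet

theorem measurableSet_below : MeasurableSet (below e φ) :=
  (isOpen_lt continuous_const H.continuous_depth).measurableSet

end IsGraphFunction

end Regions

/-! ### The projected seminorm, region by region. -/

section SeminormEstimate

variable {V : Type*} [NormedAddCommGroup V] [InnerProductSpace ℝ V] [FiniteDimensional ℝ V]
  [MeasurableSpace V] [BorelSpace V] (μ : Measure V) [μ.IsAddHaarMeasure]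

namespace IsGraphFunction

variable {e : V} {φ : V → ℝ} {M : ℝ≥0} (H : IsGraphFunction e φ M)
include H

theorem lintegral_eq_above_add_below (g : V → ℝ≥0∞) :
    ∫⁻ x, g x ∂μ = ∫⁻ x in above e φ, g x ∂μ + ∫⁻ x in below e φ, g x ∂μ := by
  rw [← lintegral_add_compl g H.measurableSet_above]
  congr 1
  have h : below e φ =ᵐ[μ] (above e φ)ᶜ := by
    have h0 : ∀ᵐ x ∂μ, depth e φ x ≠ 0 := by
      rw [ae_iff]; simpa using H.measure_graph μ
    filter_upwards [h0] with x hx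
    refine propext ⟨fun h => not_lt.2 (le_of_lt h), fun h => ?_⟩
    exact lt_of_le_of_ne (not_lt.1 h) hx.symm
  exact (setLIntegral_congr h).symm

/-- A Hardy-type estimate: the difference of the vertical components at the two reflected points,
weighted by a power of the depth, is controlled by the projected seminorm. -/
theorem lintegral_vertical_diff_le {p σ : ℝ} (hp : 0 < p) (hσ : 0 < σ) {u : V → V}
    (hu : Continuous u) :
    μ (Metric.ball 0 (1 / 2)) * ∫⁻ x in below e φ,
      ‖inner ℝ e (u (vshift e φ 2 x)) - inner ℝ e (u (vshift e φ 3 x))‖ₑ ^ p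
        / ENNReal.ofReal (depth e φ x) ^ σ ∂μ
      ≤ 8 ^ p * (5 * 7 ^ Module.finrank ℝ V) * ∫⁻ x in above e φ, ∫⁻ y in above e φ,
        projKernel p (Module.finrank ℝ V + σ + p) u x y ∂μ ∂μ := by
  set d := Module.finrank ℝ V
  set b : ℝ := d + σ + p
  set D := above e φ
  have hD : MeasurableSet D := H.measurableSet_above
  -- With the kernel cut off outside D, whole-space substitutions apply to integrals over D.
  set K := restrictKernel D (projKernel p b u)
  have hK : Measurable (Function.uncurry K) :=
    measurable_restrictKernel hD (measurable_projKernel p b hu)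
  set S := vshift e φ
  have hS (t : ℝ) : Measurable (S t) := (H.continuous_vshift t).measurable
  have hKadd (t : ℝ) : Measurable (Function.uncurry fun x h => K (S t x) (S (5 / 2) x + h)) :=
    hK.comp (f := fun q : V × V => (S t q.1, S (5 / 2) q.1 + q.2)) (by fun_prop)
  have hKsub (t : ℝ) : Measurable (Function.uncurry fun x h => K (S t x) (S (5 / 2) x - h)) :=
    hK.comp (f := fun q : V × V => (S t q.1, S (5 / 2) q.1 - q.2)) (by fun_prop)
  -- Average `vertical_diff_le` over the ball of radius r / 2. Its left side does not depend on h,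
  -- and the volume of the ball, proportional to r^d, turns the weight r^{-(d + σ)} into r^{-σ}.
  have hpt : ∀ x ∈ below e φ, μ (Metric.ball 0 (1 / 2)) *
      (‖inner ℝ e (u (S 2 x)) - inner ℝ e (u (S 3 x))‖ₑ ^ p / ENNReal.ofReal (depth e φ x) ^ σ)
      ≤ ∫⁻ h, 8 ^ p * (K (S 2 x) (S (5 / 2) x + h) + K (S 2 x) (S (5 / 2) x - h)
        + K (S 3 x) (S (5 / 2) x + h) + K (S 3 x) (S (5 / 2) x - h)
        + K (S (5 / 2) x + h) (S (5 / 2) x - h)) ∂μ := by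
    intro x hx
    have hr : 0 < depth e φ x := hx
    set r := depth e φ x with hr_def
    have hR0 : ENNReal.ofReal r ≠ 0 := by simpa using hr
    have hRt : ENNReal.ofReal r ≠ ∞ := by simp
    have hcancel (X κ : ℝ≥0∞) : κ * (X / ENNReal.ofReal r ^ σ)
        = X / ENNReal.ofReal r ^ (d + σ) * (ENNReal.ofReal r ^ d * κ) := by
      rw [ENNReal.rpow_add _ _ hR0 hRt, ENNReal.rpow_natCast, div_eq_mul_inv, div_eq_mul_inv,
        ENNReal.mul_inv (Or.inr (ENNReal.rpow_ne_top_of_nonneg hσ.le hRt))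
          (Or.inl (ENNReal.pow_ne_top hRt))]
      calc κ * (X * (ENNReal.ofReal r ^ σ)⁻¹)
          = (ENNReal.ofReal r ^ d)⁻¹ * ENNReal.ofReal r ^ d *
            (κ * (X * (ENNReal.ofReal r ^ σ)⁻¹)) := by
            rw [ENNReal.inv_mul_cancel (pow_ne_zero _ hR0) (ENNReal.pow_ne_top hRt), one_mul]
        _ = _ := by ring
    calc _ = ∫⁻ _ in Metric.ball (0 : V) (r / 2),
          ‖inner ℝ e (u (S 2 x)) - inner ℝ e (u (S 3 x))‖ₑ ^ p
            / ENNReal.ofReal r ^ (d + σ) ∂μ := by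
          rw [setLIntegral_const, div_eq_mul_one_div r 2, Measure.addHaar_ball_mul_of_pos μ 0 hr,
            ENNReal.ofReal_pow hr.le]
          exact hcancel _ _
      _ ≤ ∫⁻ h in Metric.ball (0 : V) (r / 2), _ ∂μ := by
          refine setLIntegral_mono' measurableSet_ball fun h hh => ?_
          have hh : ‖h‖ < r / 2 := by simpa using hh
          have h2 := H.vshift_mem_above (t := 2) (by norm_num) hx
          have h3 := H.vshift_mem_above (t := 3) (by norm_num) hx
          have ha := H.vshift_add_mem_above hx hh
          have hs : S (5 / 2) x - h ∈ D := by
            rw [sub_eq_add_neg]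
            exact H.vshift_add_mem_above hx (by rwa [norm_neg])
          simp only [K]
          rw [restrictKernel_of_mem h2 ha, restrictKernel_of_mem h2 hs,
            restrictKernel_of_mem h3 ha, restrictKernel_of_mem h3 hs,
            restrictKernel_of_mem ha hs]
          exact H.vertical_diff_le hp (by positivity) hr hh
      _ ≤ _ := setLIntegral_le_lintegral _ _
  have hball : μ (Metric.ball (0 : V) (1 / 2)) ≠ ∞ := measure_ball_lt_top.ne
  rw [← lintegral_restrictKernel μ hD, ← lintegral_const_mul' _ _ hball]
  have h5 : |(5 / 3 : ℝ)| ≤ 3 := by norm_num [abs_le]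
  have hadd (t s : ℝ) (hs : |s| ≤ 3) (hst : t + s * (1 - t) = 0) :
      ∫⁻ x, ∫⁻ h, K (S t x) (S (5 / 2) x + h) ∂μ ∂μ ≤ 7 ^ d * ∫⁻ x, ∫⁻ y, K x y ∂μ ∂μ := by
    -- On a side of the parallelogram only one endpoint involves h, so translation invariance
    -- removes the midpoint. The second diagonal needs the sum-difference substitution instead.
    simp only [fun x => lintegral_add_left_eq_self (μ := μ) (K (S t x)) (S (5 / 2) x)]
    exact H.lintegral_comp_vshift_left_le μ hK hs hst
  have hsub (t s : ℝ) (hs : |s| ≤ 3) (hst : t + s * (1 - t) = 0) :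
      ∫⁻ x, ∫⁻ h, K (S t x) (S (5 / 2) x - h) ∂μ ∂μ ≤ 7 ^ d * ∫⁻ x, ∫⁻ y, K x y ∂μ ∂μ := by
    simp only [fun x => lintegral_sub_left_eq_self (μ := μ) (K (S t x)) (S (5 / 2) x)]
    exact H.lintegral_comp_vshift_left_le μ hK hs hst
  have h2 : (2 : ℝ) + 2 * (1 - 2) = 0 := by norm_num
  have h3 : (3 : ℝ) + 3 / 2 * (1 - 3) = 0 := by norm_num
  have h2' : |(2 : ℝ)| ≤ 3 := by norm_num [abs_le]
  have h3' : |(3 / 2 : ℝ)| ≤ 3 := by norm_num [abs_le]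
  calc _ ≤ ∫⁻ x, ∫⁻ h, 8 ^ p * (K (S 2 x) (S (5 / 2) x + h) + K (S 2 x) (S (5 / 2) x - h)
        + K (S 3 x) (S (5 / 2) x + h) + K (S 3 x) (S (5 / 2) x - h)
        + K (S (5 / 2) x + h) (S (5 / 2) x - h)) ∂μ ∂μ :=
        (setLIntegral_mono' H.measurableSet_below hpt).trans (setLIntegral_le_lintegral _ _)
    _ = 8 ^ p * (∫⁻ x, ∫⁻ h, K (S 2 x) (S (5 / 2) x + h) ∂μ ∂μ
        + ∫⁻ x, ∫⁻ h, K (S 2 x) (S (5 / 2) x - h) ∂μ ∂μ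
        + ∫⁻ x, ∫⁻ h, K (S 3 x) (S (5 / 2) x + h) ∂μ ∂μ
        + ∫⁻ x, ∫⁻ h, K (S 3 x) (S (5 / 2) x - h) ∂μ ∂μ
        + ∫⁻ x, ∫⁻ h, K (S (5 / 2) x + h) (S (5 / 2) x - h) ∂μ ∂μ) := by
        have h8 : (8 : ℝ≥0∞) ^ p ≠ ∞ := ENNReal.rpow_ne_top_of_nonneg hp.le (by simp)
        simp only [lintegral_const_mul' _ _ h8]
        rw [lintegral_lintegral_add, lintegral_lintegral_add, lintegral_lintegral_add,
          lintegral_lintegral_add μ (hKadd 2)]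
        · exact (hKadd 2).add (hKsub 2)
        · exact ((hKadd 2).add (hKsub 2)).add (hKadd 3)
        · exact (((hKadd 2).add (hKsub 2)).add (hKadd 3)).add (hKsub 3)
    _ ≤ 8 ^ p * (7 ^ d * (∫⁻ x, ∫⁻ y, K x y ∂μ ∂μ) + 7 ^ d * (∫⁻ x, ∫⁻ y, K x y ∂μ ∂μ)
        + 7 ^ d * (∫⁻ x, ∫⁻ y, K x y ∂μ ∂μ) + 7 ^ d * (∫⁻ x, ∫⁻ y, K x y ∂μ ∂μ)
        + 7 ^ d * (∫⁻ x, ∫⁻ y, K x y ∂μ ∂μ)) := by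
        gcongr 8 ^ p * (?_ + ?_ + ?_ + ?_ + ?_)
        · exact hadd 2 2 h2' h2
        · exact hsub 2 2 h2' h2
        · exact hadd 3 (3 / 2) h3' h3
        · exact hsub 3 (3 / 2) h3' h3
        · exact H.lintegral_add_sub_vshift_le μ hK h5 (by norm_num)
    _ = _ := by ring

theorem lintegral_below_below_le {p a : ℝ} (hp : 0 < p) (ha : 0 ≤ a) {u : V → V}
    (hu : Continuous u) (hu0 : ∀ x, 0 ≤ depth e φ x → u x = 0) :
    ∫⁻ x in below e φ, ∫⁻ y in below e φ, projKernel p (a + p) (extendField e φ u) x y ∂μ ∂μ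
      ≤ 24 ^ p * 7 ^ (a + p) * (2 * (7 ^ Module.finrank ℝ V * 7 ^ Module.finrank ℝ V)) *
      (∫⁻ x in above e φ, ∫⁻ y in above e φ, projKernel p (a + p) u x y ∂μ ∂μ
      + M ^ p * ∫⁻ x in above e φ, ∫⁻ y in above e φ, diffKernel p a u x y ∂μ ∂μ) := by
  set d := Module.finrank ℝ V
  set D := above e φ
  have hD : MeasurableSet D := H.measurableSet_above
  have hN : MeasurableSet (below e φ) := H.measurableSet_below
  rw [← lintegral_restrictKernel μ hD, ← lintegral_restrictKernel μ hD]
  set K := restrictKernel D (projKernel p (a + p) u)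
  set L := restrictKernel D (diffKernel p a u)
  have hK : Measurable (Function.uncurry K) :=
    measurable_restrictKernel hD (measurable_projKernel p _ hu)
  have hL : Measurable (Function.uncurry L) :=
    measurable_restrictKernel hD (measurable_diffKernel p _ hu)
  set S := vshift e φ
  have hS (t : ℝ) : Measurable (S t) := (H.continuous_vshift t).measurable
  have hKS (t : ℝ) : Measurable (Function.uncurry fun x y => K (S t x) (S t y)) :=
    hK.comp (f := fun q : V × V => (S t q.1, S t q.2)) (by fun_prop)
  have hLS (t : ℝ) : Measurable (Function.uncurry fun x y => M ^ p * L (S t x) (S t y)) :=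
    (hL.comp (f := fun q : V × V => (S t q.1, S t q.2)) (by fun_prop)).const_mul _
  have h2 : (2 : ℝ) + 2 * (1 - 2) = 0 := by norm_num
  have h3 : (3 : ℝ) + 3 / 2 * (1 - 3) = 0 := by norm_num
  have h2' : |(2 : ℝ)| ≤ 3 := by norm_num [abs_le]
  have h3' : |(3 / 2 : ℝ)| ≤ 3 := by norm_num [abs_le]
  have hMp : (M : ℝ≥0∞) ^ p ≠ ∞ := ENNReal.rpow_ne_top_of_nonneg hp.le (by simp)
  have hC : (24 : ℝ≥0∞) ^ p * 7 ^ (a + p) ≠ ∞ :=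
    ENNReal.mul_ne_top (ENNReal.rpow_ne_top_of_nonneg hp.le (by simp))
      (ENNReal.rpow_ne_top_of_nonneg (by positivity) (by simp))
  calc _ ≤ ∫⁻ x in below e φ, ∫⁻ y in below e φ, 24 ^ p * 7 ^ (a + p) *
        (K (S 2 x) (S 2 y) + K (S 3 x) (S 3 y) + M ^ p * L (S 2 x) (S 2 y)
          + M ^ p * L (S 3 x) (S 3 y)) ∂μ ∂μ := by
        refine setLIntegral_mono' hN fun x hx => setLIntegral_mono' hN fun y hy => ?_
        have h2x := H.vshift_mem_above (t := 2) (by norm_num) hx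
        have h3x := H.vshift_mem_above (t := 3) (by norm_num) hx
        have h2y := H.vshift_mem_above (t := 2) (by norm_num) hy
        have h3y := H.vshift_mem_above (t := 3) (by norm_num) hy
        simp only [K, L]
        rw [restrictKernel_of_mem h2x h2y, restrictKernel_of_mem h3x h3y,
          restrictKernel_of_mem h2x h2y, restrictKernel_of_mem h3x h3y]
        exact H.projKernel_extendField_below_le hu0 hp ha hx hy
    _ ≤ ∫⁻ x, ∫⁻ y, 24 ^ p * 7 ^ (a + p) *
        (K (S 2 x) (S 2 y) + K (S 3 x) (S 3 y) + M ^ p * L (S 2 x) (S 2 y)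
          + M ^ p * L (S 3 x) (S 3 y)) ∂μ ∂μ :=
        (setLIntegral_le_lintegral _ _).trans
          (lintegral_mono fun x => setLIntegral_le_lintegral _ _)
    _ = 24 ^ p * 7 ^ (a + p) * (∫⁻ x, ∫⁻ y, K (S 2 x) (S 2 y) ∂μ ∂μ
        + ∫⁻ x, ∫⁻ y, K (S 3 x) (S 3 y) ∂μ ∂μ
        + M ^ p * ∫⁻ x, ∫⁻ y, L (S 2 x) (S 2 y) ∂μ ∂μ
        + M ^ p * ∫⁻ x, ∫⁻ y, L (S 3 x) (S 3 y) ∂μ ∂μ) := by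
        simp only [lintegral_const_mul' _ _ hC]
        rw [lintegral_lintegral_add, lintegral_lintegral_add, lintegral_lintegral_add μ (hKS 2)]
        · simp only [lintegral_const_mul' _ _ hMp]
        · exact (hKS 2).add (hKS 3)
        · exact ((hKS 2).add (hKS 3)).add (hLS 2)
    _ ≤ 24 ^ p * 7 ^ (a + p) * (7 ^ d * 7 ^ d * (∫⁻ x, ∫⁻ y, K x y ∂μ ∂μ)
        + 7 ^ d * 7 ^ d * (∫⁻ x, ∫⁻ y, K x y ∂μ ∂μ)
        + M ^ p * (7 ^ d * 7 ^ d * (∫⁻ x, ∫⁻ y, L x y ∂μ ∂μ))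
        + M ^ p * (7 ^ d * 7 ^ d * (∫⁻ x, ∫⁻ y, L x y ∂μ ∂μ))) := by
        gcongr 24 ^ p * 7 ^ (a + p) * (?_ + ?_ + M ^ p * ?_ + M ^ p * ?_)
        · exact H.lintegral_comp_vshift_both_le μ hK h2' h2
        · exact H.lintegral_comp_vshift_both_le μ hK h3' h3
        · exact H.lintegral_comp_vshift_both_le μ hL h2' h2
        · exact H.lintegral_comp_vshift_both_le μ hL h3' h3
    _ = _ := by ring

theorem lintegral_below_above_le {p σ : ℝ} (hp : 0 < p) (hσ : 0 < σ) {C : ℝ≥0∞} (hC : C ≠ ∞)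
    (htail : ∀ (x : V) (r : ℝ), 0 < r →
      ∫⁻ y in {y | r ≤ 2 * ‖x - y‖}, 1 / ‖x - y‖ₑ ^ (Module.finrank ℝ V + σ) ∂μ
        ≤ C / ENNReal.ofReal r ^ σ)
    {u : V → V} (hu : Continuous u) (hu0 : ∀ x, 0 ≤ depth e φ x → u x = 0) :
    ∫⁻ x in below e φ, ∫⁻ y in above e φ,
        projKernel p (Module.finrank ℝ V + σ + p) (extendField e φ u) x y ∂μ ∂μ
      ≤ 72 ^ p * 7 ^ (Module.finrank ℝ V + σ + p) * (2 * 7 ^ Module.finrank ℝ V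
        + C * (μ (Metric.ball 0 (1 / 2)))⁻¹ * (8 ^ p * (5 * 7 ^ Module.finrank ℝ V))) *
      ∫⁻ x in above e φ, ∫⁻ y in above e φ,
        projKernel p (Module.finrank ℝ V + σ + p) u x y ∂μ ∂μ := by
  set d := Module.finrank ℝ V
  set a : ℝ := d + σ
  have ha : 0 ≤ a := by positivity
  set D := above e φ
  have hD : MeasurableSet D := H.measurableSet_above
  have hN : MeasurableSet (below e φ) := H.measurableSet_below
  have hardy := H.lintegral_vertical_diff_le μ hp hσ hu
  rw [← lintegral_restrictKernel μ hD] at hardy ⊢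
  set K := restrictKernel D (projKernel p (a + p) u)
  have hK : Measurable (Function.uncurry K) :=
    measurable_restrictKernel hD (measurable_projKernel p _ hu)
  set S := vshift e φ
  have hS (t : ℝ) : Measurable (S t) := (H.continuous_vshift t).measurable
  have hKS (t : ℝ) : Measurable (Function.uncurry fun x y => K (S t x) y) :=
    hK.comp (f := fun q : V × V => (S t q.1, q.2)) (by fun_prop)
  have hKI (t : ℝ) : Measurable fun x => ∫⁻ y, K (S t x) y ∂μ := (hKS t).lintegral_prod_right'
  have h2 : (2 : ℝ) + 2 * (1 - 2) = 0 := by norm_num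
  have h3 : (3 : ℝ) + 3 / 2 * (1 - 3) = 0 := by norm_num
  have h2' : |(2 : ℝ)| ≤ 3 := by norm_num [abs_le]
  have h3' : |(3 / 2 : ℝ)| ≤ 3 := by norm_num [abs_le]
  set T : V → ℝ≥0∞ := fun x => ‖inner ℝ e (u (S 2 x)) - inner ℝ e (u (S 3 x))‖ₑ ^ p
  have hT : ∀ x, T x ≠ ∞ := fun x => ENNReal.rpow_ne_top_of_nonneg hp.le (by simp)
  have hCt : (72 : ℝ≥0∞) ^ p * 7 ^ (a + p) ≠ ∞ :=
    ENNReal.mul_ne_top (ENNReal.rpow_ne_top_of_nonneg hp.le (by simp))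
      (ENNReal.rpow_ne_top_of_nonneg (by positivity) (by simp))
  have hball : μ (Metric.ball (0 : V) (1 / 2)) ≠ ∞ := measure_ball_lt_top.ne
  have hball0 : μ (Metric.ball (0 : V) (1 / 2)) ≠ 0 :=
    (Metric.measure_ball_pos μ 0 (by norm_num)).ne'
  have hinner : ∀ x ∈ below e φ,
      ∫⁻ y in D, projKernel p (a + p) (extendField e φ u) x y ∂μ ≤ 72 ^ p * 7 ^ (a + p) *
        (∫⁻ y, K (S 2 x) y ∂μ + ∫⁻ y, K (S 3 x) y ∂μ
          + C * (T x / ENNReal.ofReal (depth e φ x) ^ σ)) := by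
    intro x hx
    have hx0 : 0 < depth e φ x := hx
    calc _ ≤ ∫⁻ y in D, 72 ^ p * 7 ^ (a + p) *
          (K (S 2 x) y + K (S 3 x) y + T x * (1 / ‖x - y‖ₑ ^ a)) ∂μ := by
          refine setLIntegral_mono' hD fun y hy => ?_
          simp only [K]
          rw [restrictKernel_of_mem (H.vshift_mem_above (t := 2) (by norm_num) hx) hy,
            restrictKernel_of_mem (H.vshift_mem_above (t := 3) (by norm_num) hx) hy,
            mul_one_div]
          exact H.projKernel_extendField_cross_le hu0 hp ha hx hy
      _ = 72 ^ p * 7 ^ (a + p) * (∫⁻ y in D, K (S 2 x) y ∂μ + ∫⁻ y in D, K (S 3 x) y ∂μ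
          + T x * ∫⁻ y in D, 1 / ‖x - y‖ₑ ^ a ∂μ) := by
          rw [lintegral_const_mul' _ _ hCt, lintegral_add_left, lintegral_add_left,
            lintegral_const_mul' _ _ (hT x)]
          · exact (hKS 2).of_uncurry_left
          · exact (hKS 2).of_uncurry_left.add (hKS 3).of_uncurry_left
      _ ≤ _ := by
          gcongr 72 ^ p * 7 ^ (a + p) * (?_ + ?_ + ?_)
          · exact setLIntegral_le_lintegral _ _
          · exact setLIntegral_le_lintegral _ _
          · calc _ ≤ T x * (C / ENNReal.ofReal (depth e φ x) ^ σ) := by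
                  gcongr
                  refine le_trans ?_ (htail x _ hx0)
                  -- Every point above the graph is at distance at least half the depth of x, so D
                  -- lies in the tail region.
                  exact lintegral_mono_set fun y hy => H.depth_le hy
              _ = _ := by rw [div_eq_mul_inv, div_eq_mul_inv]; ring
  have hhardy : ∫⁻ x in below e φ, T x / ENNReal.ofReal (depth e φ x) ^ σ ∂μ
      ≤ (μ (Metric.ball 0 (1 / 2)))⁻¹ *
        (8 ^ p * (5 * 7 ^ d) * ∫⁻ x, ∫⁻ y, K x y ∂μ ∂μ) := by
    rw [mul_comm, ← div_eq_mul_inv, ENNReal.le_div_iff_mul_le (Or.inl hball0) (Or.inl hball),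
      mul_comm]
    exact hardy
  calc _ ≤ ∫⁻ x in below e φ, 72 ^ p * 7 ^ (a + p) *
        (∫⁻ y, K (S 2 x) y ∂μ + ∫⁻ y, K (S 3 x) y ∂μ
          + C * (T x / ENNReal.ofReal (depth e φ x) ^ σ)) ∂μ := setLIntegral_mono' hN hinner
    _ = 72 ^ p * 7 ^ (a + p) * (∫⁻ x in below e φ, ∫⁻ y, K (S 2 x) y ∂μ ∂μ
        + ∫⁻ x in below e φ, ∫⁻ y, K (S 3 x) y ∂μ ∂μ
        + C * ∫⁻ x in below e φ, T x / ENNReal.ofReal (depth e φ x) ^ σ ∂μ) := by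
        rw [lintegral_const_mul' _ _ hCt, lintegral_add_left, lintegral_add_left (hKI 2),
          lintegral_const_mul' _ _ hC]
        exact (hKI 2).add (hKI 3)
    _ ≤ 72 ^ p * 7 ^ (a + p) * (7 ^ d * (∫⁻ x, ∫⁻ y, K x y ∂μ ∂μ)
        + 7 ^ d * (∫⁻ x, ∫⁻ y, K x y ∂μ ∂μ)
        + C * ((μ (Metric.ball 0 (1 / 2)))⁻¹ *
        (8 ^ p * (5 * 7 ^ d) * ∫⁻ x, ∫⁻ y, K x y ∂μ ∂μ))) := by
        gcongr 72 ^ p * 7 ^ (a + p) * (?_ + ?_ + C * ?_)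
        · exact (setLIntegral_le_lintegral _ _).trans
            (H.lintegral_comp_vshift_left_le μ hK h2' h2)
        · exact (setLIntegral_le_lintegral _ _).trans
            (H.lintegral_comp_vshift_left_le μ hK h3' h3)
    _ = _ := by ring

/-- The kernel is symmetric, so the two mixed regions contribute equally. -/
theorem lintegral_projKernel_eq {p b : ℝ} {u : V → V} (hu : Continuous u)
    (hu0 : ∀ x, 0 ≤ depth e φ x → u x = 0) :
    ∫⁻ x, ∫⁻ y, projKernel p b (extendField e φ u) x y ∂μ ∂μ =
      ∫⁻ x in above e φ, ∫⁻ y in above e φ, projKernel p b u x y ∂μ ∂μ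
      + 2 * ∫⁻ x in below e φ, ∫⁻ y in above e φ,
        projKernel p b (extendField e φ u) x y ∂μ ∂μ
      + ∫⁻ x in below e φ, ∫⁻ y in below e φ,
        projKernel p b (extendField e φ u) x y ∂μ ∂μ := by
  set F := projKernel p b (extendField e φ u)
  have hD := H.measurableSet_above
  have hF : Measurable (Function.uncurry F) :=
    measurable_projKernel p b (H.continuous_extendField hu)
  have hFD : Measurable fun x => ∫⁻ y in above e φ, F x y ∂μ := hF.lintegral_prod_right'
  have hswap : ∫⁻ x in above e φ, ∫⁻ y in below e φ, F x y ∂μ ∂μ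
      = ∫⁻ x in below e φ, ∫⁻ y in above e φ, F x y ∂μ ∂μ := by
    rw [lintegral_lintegral_swap hF.aemeasurable]
    exact lintegral_congr fun x => lintegral_congr fun y => projKernel_comm _ _ _ _ _
  have hDD : ∫⁻ x in above e φ, ∫⁻ y in above e φ, F x y ∂μ ∂μ
      = ∫⁻ x in above e φ, ∫⁻ y in above e φ, projKernel p b u x y ∂μ ∂μ := by
    refine setLIntegral_congr_fun hD fun x hx => setLIntegral_congr_fun hD fun y hy => ?_
    simp only [F, projKernel, projDiff]
    rw [H.extendField_of_above hu0 hx, H.extendField_of_above hu0 hy]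
  rw [H.lintegral_eq_above_add_below μ]
  simp only [fun x => H.lintegral_eq_above_add_below μ (F x)]
  rw [lintegral_add_left hFD, lintegral_add_left hFD, hswap, hDD]
  ring

end IsGraphFunction

/-- The estimate of the projected seminorm of the extension, uniformly over graphs. -/
theorem exists_lintegral_projKernel_extendField_le {p σ : ℝ} (hp : 0 < p) (hσ : 0 < σ) :
    ∃ C : ℝ≥0, ∀ (e : V) (φ : V → ℝ) (M : ℝ≥0), IsGraphFunction e φ M →
      ∀ u : V → V, Continuous u → (∀ x, 0 ≤ depth e φ x → u x = 0) →
      ∫⁻ x, ∫⁻ y, projKernel p (Module.finrank ℝ V + σ + p) (extendField e φ u) x y ∂μ ∂μ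
      ≤ C * (∫⁻ x in above e φ, ∫⁻ y in above e φ,
          projKernel p (Module.finrank ℝ V + σ + p) u x y ∂μ ∂μ
        + M ^ p * ∫⁻ x in above e φ, ∫⁻ y in above e φ,
          diffKernel p (Module.finrank ℝ V + σ) u x y ∂μ ∂μ) := by
  obtain ⟨C, hC, htail⟩ := exists_lintegral_tail_le μ hσ
  set d := Module.finrank ℝ V
  set a : ℝ := d + σ
  have ha : 0 ≤ a := by positivity
  set C₁ : ℝ≥0∞ := 72 ^ p * 7 ^ (a + p) * (2 * 7 ^ d
        + C * (μ (Metric.ball 0 (1 / 2)))⁻¹ * (8 ^ p * (5 * 7 ^ d)))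
  set C₂ : ℝ≥0∞ := 24 ^ p * 7 ^ (a + p) * (2 * (7 ^ d * 7 ^ d))
  have hball0 : μ (Metric.ball (0 : V) (1 / 2)) ≠ 0 :=
    (Metric.measure_ball_pos μ 0 (by norm_num)).ne'
  have hpow (k : ℝ≥0∞) (hk : k ≠ ∞) (q : ℝ) (hq : 0 ≤ q) : k ^ q ≠ ∞ :=
    ENNReal.rpow_ne_top_of_nonneg hq hk
  have hd : (7 : ℝ≥0∞) ^ d ≠ ∞ := ENNReal.pow_ne_top (by simp)
  have h7 := hpow 7 (by simp) (a + p) (by positivity)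
  have hC₁ : C₁ ≠ ∞ := by
    refine ENNReal.mul_ne_top (ENNReal.mul_ne_top (hpow _ (by simp) _ hp.le) h7)
      (ENNReal.add_ne_top.2 ⟨ENNReal.mul_ne_top (by simp) hd, ?_⟩)
    refine ENNReal.mul_ne_top (ENNReal.mul_ne_top hC (ENNReal.inv_ne_top.2 hball0))
      (ENNReal.mul_ne_top (hpow _ (by simp) _ hp.le) (ENNReal.mul_ne_top (by simp) hd))
  have hC₂ : C₂ ≠ ∞ :=
    ENNReal.mul_ne_top (ENNReal.mul_ne_top (hpow _ (by simp) _ hp.le) h7)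
      (ENNReal.mul_ne_top (by simp) (ENNReal.mul_ne_top hd hd))
  have hC₃ : 1 + 2 * C₁ + C₂ ≠ ∞ :=
    ENNReal.add_ne_top.2 ⟨ENNReal.add_ne_top.2 ⟨by simp, ENNReal.mul_ne_top (by simp) hC₁⟩, hC₂⟩
  refine ⟨(1 + 2 * C₁ + C₂).toNNReal, fun e φ M H u hu hu0 => ?_⟩
  rw [ENNReal.coe_toNNReal hC₃, H.lintegral_projKernel_eq μ hu hu0]
  have h1 := H.lintegral_below_above_le μ hp hσ hC htail hu hu0
  have h2 := H.lintegral_below_below_le μ hp ha hu hu0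
  set X := ∫⁻ x in above e φ, ∫⁻ y in above e φ, projKernel p (a + p) u x y ∂μ ∂μ
  set Y := M ^ p * ∫⁻ x in above e φ, ∫⁻ y in above e φ, diffKernel p a u x y ∂μ ∂μ
  calc _ ≤ X + 2 * (C₁ * X) + C₂ * (X + Y) := by gcongr
    _ ≤ (X + Y) + 2 * (C₁ * (X + Y)) + C₂ * (X + Y) := by gcongr <;> exact le_self_add
    _ = _ := by ring

end SeminormEstimate

/-! ### Smoothness, support, C^1 and L^p bounds of the extension. -/

section AbstractExtension

variable {V : Type*} [NormedAddCommGroup V] [InnerProductSpace ℝ V]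

/-- The linear map acting by `α` on the orthogonal complement of the unit vector `e` and by
`α + β` on its span. -/
noncomputable def axialMap (e : V) (α β : ℝ) : V →L[ℝ] V :=
  α • ContinuousLinearMap.id ℝ V + β • (innerSL ℝ e).smulRight e

theorem axialMap_apply (e : V) (α β : ℝ) (v : V) :
    axialMap e α β v = α • v + (β * inner ℝ e v) • e := by
  simp [axialMap, mul_smul]

theorem norm_axialMap_le {e : V} (he : ‖e‖ = 1) (α β : ℝ) : ‖axialMap e α β‖ ≤ |α| + |β| := by
  refine ContinuousLinearMap.opNorm_le_bound _ (by positivity) fun v => ?_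
  rw [axialMap_apply]
  refine (norm_add_le _ _).trans ?_
  rw [norm_smul, norm_smul, he, mul_one, norm_mul, Real.norm_eq_abs, Real.norm_eq_abs, add_mul]
  gcongr
  simpa [he] using norm_inner_le_norm (𝕜 := ℝ) e v

theorem extendField_eq (e : V) (φ : V → ℝ) (u : V → V) (x : V) :
    extendField e φ u x
      = u x + axialMap e 3 (-6) (u (vshift e φ 2 x)) + axialMap e (-2) 6 (u (vshift e φ 3 x)) := by
  rw [extendField, axialMap_apply, axialMap_apply]
  module

theorem contDiff_vshift {e : V} {φ : V → ℝ} (hφ : ContDiff ℝ 1 φ) (t : ℝ) :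
    ContDiff ℝ 1 (vshift e φ t) := by
  have h : ContDiff ℝ 1 fun x : V => inner ℝ e x := contDiff_const.inner ℝ contDiff_id
  unfold vshift depth
  fun_prop

theorem contDiff_extendField {e : V} {φ : V → ℝ} (hφ : ContDiff ℝ 1 φ) {u : V → V}
    (hu : ContDiff ℝ 1 u) : ContDiff ℝ 1 (extendField e φ u) := by
  have h2 := hu.comp (contDiff_vshift (e := e) hφ 2)
  have h3 := hu.comp (contDiff_vshift (e := e) hφ 3)
  have h : extendField e φ u = fun x => u x + axialMap e 3 (-6) ((u ∘ vshift e φ 2) x)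
      + axialMap e (-2) 6 ((u ∘ vshift e φ 3) x) := funext (extendField_eq e φ u)
  rw [h]
  exact (hu.add ((axialMap e 3 (-6)).contDiff.comp h2)).add
    ((axialMap e (-2) 6).contDiff.comp h3)

namespace IsGraphFunction

variable {e : V} {φ : V → ℝ} {M : ℝ≥0} (H : IsGraphFunction e φ M)
include H

theorem hasCompactSupport_extendField {u : V → V} (hu : HasCompactSupport u) :
    HasCompactSupport (extendField e φ u) := by
  -- These images are the preimages of the support under `vshift` with parameters 2 and 3.
  have hK : IsCompact (tsupport u ∪ vshift e φ 2 '' tsupport u ∪ vshift e φ (3 / 2) '' tsupport u) :=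
    (hu.isCompact.union (hu.isCompact.image (H.continuous_vshift 2))).union
      (hu.isCompact.image (H.continuous_vshift (3 / 2)))
  refine HasCompactSupport.intro hK fun x hx => ?_
  simp only [mem_union, not_or] at hx
  have h1 : u x = 0 := image_eq_zero_of_notMem_tsupport hx.1.1
  have h2 : u (vshift e φ 2 x) = 0 := image_eq_zero_of_notMem_tsupport fun h =>
    hx.1.2 ⟨_, h, H.leftInverse_vshift (by norm_num) x⟩
  have h3 : u (vshift e φ 3 x) = 0 := image_eq_zero_of_notMem_tsupport fun h =>
    hx.2 ⟨_, h, H.leftInverse_vshift (by norm_num) x⟩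
  simp [extendField_eq, h1, h2, h3]

/-- The bounds are 3 + 6 = 9 and 2 + 6 = 8; one common constant is kept. -/
theorem nnnorm_axialMap_le : ‖axialMap e 3 (-6)‖₊ ≤ 9 ∧ ‖axialMap e (-2) 6‖₊ ≤ 9 := by
  constructor <;> rw [← NNReal.coe_le_coe] <;>
    refine (norm_axialMap_le H.norm_eq _ _).trans ?_ <;> norm_num

theorem enorm_extendField_le (u : V → V) (x : V) : ‖extendField e φ u x‖ₑ
    ≤ ‖u x‖ₑ + 9 * ‖u (vshift e φ 2 x)‖ₑ + 9 * ‖u (vshift e φ 3 x)‖ₑ := by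
  have h (L : V →L[ℝ] V) (hL : ‖L‖₊ ≤ 9) (v : V) : ‖L v‖ₑ ≤ 9 * ‖v‖ₑ := by
    refine (L.le_opENorm v).trans ?_
    gcongr
    rw [enorm_eq_nnnorm]
    exact_mod_cast hL
  rw [extendField_eq]
  refine (enorm_add_le _ _).trans (add_le_add ((enorm_add_le _ _).trans ?_) ?_)
  · exact add_le_add le_rfl (h _ H.nnnorm_axialMap_le.1 _)
  · exact h _ H.nnnorm_axialMap_le.2 _

theorem enorm_fderiv_extendField_le (hφ : ContDiff ℝ 1 φ) {u : V → V} (hu : ContDiff ℝ 1 u)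
    (x : V) : ‖fderiv ℝ (extendField e φ u) x‖ₑ ≤ ‖fderiv ℝ u x‖ₑ
      + 63 * ‖fderiv ℝ u (vshift e φ 2 x)‖ₑ + 63 * ‖fderiv ℝ u (vshift e φ 3 x)‖ₑ := by
  have hud : Differentiable ℝ u := hu.differentiable (by norm_num)
  have hS (t : ℝ) : Differentiable ℝ (vshift e φ t) :=
    (contDiff_vshift hφ t).differentiable (by norm_num)
  have hd (L : V →L[ℝ] V) (t : ℝ) : HasFDerivAt (fun x => L (u (vshift e φ t x)))
      (L.comp ((fderiv ℝ u (vshift e φ t x)).comp (fderiv ℝ (vshift e φ t) x))) x :=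
    L.hasFDerivAt.comp x ((hud _).hasFDerivAt.comp x (hS t x).hasFDerivAt)
  -- The constant 63 is 9, for the axial map, times 7, for the Lipschitz constant of the reflection.
  have hle (L : V →L[ℝ] V) (hL : ‖L‖₊ ≤ 9) (t : ℝ) (ht : |t| ≤ 3) :
      ‖L.comp ((fderiv ℝ u (vshift e φ t x)).comp (fderiv ℝ (vshift e φ t) x))‖ₑ
        ≤ 63 * ‖fderiv ℝ u (vshift e φ t x)‖ₑ := by
    refine enorm_le_mul_enorm_of_norm_le (c := 63) ?_
    have h1 : ‖L‖ ≤ 9 := hL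
    have h2 : ‖fderiv ℝ (vshift e φ t) x‖ ≤ 7 :=
      norm_fderiv_le_of_lipschitz ℝ (H.lipschitzWith_vshift ht)
    calc _ ≤ ‖L‖ * (‖fderiv ℝ u (vshift e φ t x)‖ * ‖fderiv ℝ (vshift e φ t) x‖) :=
          (L.opNorm_comp_le _).trans (by gcongr; exact ContinuousLinearMap.opNorm_comp_le _ _)
      _ ≤ 9 * (‖fderiv ℝ u (vshift e φ t x)‖ * 7) := by gcongr
      _ = _ := by push_cast; ring
  have h : extendField e φ u = fun x => u x + axialMap e 3 (-6) (u (vshift e φ 2 x))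
      + axialMap e (-2) 6 (u (vshift e φ 3 x)) := funext (extendField_eq e φ u)
  have hder := ((hud x).hasFDerivAt.add (hd (axialMap e 3 (-6)) 2)).add (hd (axialMap e (-2) 6) 3)
  rw [h]
  erw [hder.fderiv]
  refine (enorm_add_le _ _).trans (add_le_add ((enorm_add_le _ _).trans ?_) ?_)
  · exact add_le_add le_rfl (hle _ H.nnnorm_axialMap_le.1 2 (by norm_num [abs_le]))
  · exact hle _ H.nnnorm_axialMap_le.2 3 (by norm_num [abs_le])

theorem eLpNorm_extendField_le [FiniteDimensional ℝ V] [MeasurableSpace V] [BorelSpace V]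
    (μ : Measure V) [μ.IsAddHaarMeasure] {p : ℝ≥0∞} (hp : 1 ≤ p) (hp' : p ≠ ∞) {u : V → V}
    (hu : Continuous u) : eLpNorm (extendField e φ u) p μ
      ≤ (1 + 18 * (7 ^ Module.finrank ℝ V) ^ (1 / p).toReal) * eLpNorm u p μ := by
  have hcomp (s t : ℝ) (hs : |s| ≤ 3) (hst : t + s * (1 - t) = 0) :
      eLpNorm (u ∘ vshift e φ t) p μ
        ≤ (7 ^ Module.finrank ℝ V) ^ (1 / p).toReal * eLpNorm u p μ := by
    rw [← eLpNorm_map_measure hu.aestronglyMeasurable (H.continuous_vshift t).aemeasurable]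
    refine (eLpNorm_mono_measure u (H.map_vshift_le μ hs hst)).trans ?_
    rw [eLpNorm_smul_measure_of_ne_top hp', smul_eq_mul]
  have hlin (L : V →L[ℝ] V) (hL : ‖L‖₊ ≤ 9) (g : V → V) :
      eLpNorm (fun x => L (g x)) p μ ≤ 9 * eLpNorm g p μ := by
    refine eLpNorm_le_nnreal_smul_eLpNorm_of_ae_le_mul (c := 9) (.of_forall fun x => ?_) p
    exact (L.le_opNNNorm _).trans (by gcongr)
  have h : extendField e φ u = (u + fun x => axialMap e 3 (-6) ((u ∘ vshift e φ 2) x))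
      + fun x => axialMap e (-2) 6 ((u ∘ vshift e φ 3) x) := funext (extendField_eq e φ u)
  have h2 : Continuous fun x => axialMap e 3 (-6) ((u ∘ vshift e φ 2) x) :=
    (axialMap e 3 (-6)).continuous.comp (hu.comp (H.continuous_vshift 2))
  have h3 : Continuous fun x => axialMap e (-2) 6 ((u ∘ vshift e φ 3) x) :=
    (axialMap e (-2) 6).continuous.comp (hu.comp (H.continuous_vshift 3))
  set c : ℝ≥0∞ := (7 ^ Module.finrank ℝ V) ^ (1 / p).toReal
  rw [h]
  calc _ ≤ eLpNorm u p μ + 9 * (c * eLpNorm u p μ) + 9 * (c * eLpNorm u p μ) := by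
        refine (eLpNorm_add_le (hu.add h2).aestronglyMeasurable h3.aestronglyMeasurable hp).trans
          (add_le_add ((eLpNorm_add_le hu.aestronglyMeasurable h2.aestronglyMeasurable hp).trans
            (add_le_add le_rfl ?_)) ?_)
        · refine (hlin _ H.nnnorm_axialMap_le.1 _).trans ?_
          gcongr
          exact hcomp 2 2 (by norm_num [abs_le]) (by norm_num)
        · refine (hlin _ H.nnnorm_axialMap_le.2 _).trans ?_
          gcongr
          exact hcomp (3 / 2) 3 (by norm_num [abs_le]) (by norm_num)
    _ = _ := by ring

end IsGraphFunction

end AbstractExtension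

/-! ### Translation to epigraphs in Euclidean coordinates. -/

section Epigraph

variable {n : ℕ}

/-- The last vector of the standard basis. -/
noncomputable def lastVec (n : ℕ) : EuclideanSpace ℝ (Fin (n + 1)) :=
  EuclideanSpace.single (Fin.last n) 1

theorem inner_lastVec (x : EuclideanSpace ℝ (Fin (n + 1))) : inner ℝ (lastVec n) x = vert x := by
  simp [lastVec, vert, EuclideanSpace.inner_single_left]

theorem horiz_add_smul_lastVec (x : EuclideanSpace ℝ (Fin (n + 1))) (t : ℝ) :
    horiz (x + t • lastVec n) = horiz x := by
  ext i
  simp [horiz, lastVec]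

theorem norm_horiz_le (x : EuclideanSpace ℝ (Fin (n + 1))) : ‖horiz x‖ ≤ ‖x‖ := by
  rw [← sq_le_sq₀ (norm_nonneg _) (norm_nonneg _), EuclideanSpace.norm_sq_eq,
    EuclideanSpace.norm_sq_eq, Fin.sum_univ_castSucc]
  exact le_add_of_nonneg_right (sq_nonneg _)

theorem lipschitzWith_horiz :
    LipschitzWith 1 (horiz : EuclideanSpace ℝ (Fin (n + 1)) → EuclideanSpace ℝ (Fin n)) := by
  refine LipschitzWith.of_dist_le_mul fun x y => ?_
  rw [dist_eq_norm, dist_eq_norm, NNReal.coe_one, one_mul]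
  exact norm_horiz_le (x - y)

theorem contDiff_horiz :
    ContDiff ℝ 1 (horiz : EuclideanSpace ℝ (Fin (n + 1)) → EuclideanSpace ℝ (Fin n)) := by
  rw [contDiff_euclidean]
  intro i
  exact (EuclideanSpace.proj (𝕜 := ℝ) (i.castSucc : Fin (n + 1))).contDiff

theorem IsSupporting.lipschitzWith {f : EuclideanSpace ℝ (Fin n) → ℝ} (hf : IsSupporting f)
    (hM : lipConst f ≠ ∞) : LipschitzWith (lipConst f).toNNReal f := by
  have hc : Continuous fun x => ‖fderiv ℝ f x‖ₑ :=
    (hf.contDiff.continuous_fderiv (by norm_num)).enorm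
  have hae : ∀ᵐ x ∂(volume : Measure (EuclideanSpace ℝ (Fin n))),
      ‖fderiv ℝ f x‖ₑ ≤ lipConst f := by
    have h := ae_le_eLpNormEssSup (f := gradient f)
      (μ := (volume : Measure (EuclideanSpace ℝ (Fin n))))
    rw [← eLpNorm_exponent_top] at h
    filter_upwards [h] with x hx
    refine le_trans (le_of_eq ?_) hx
    rw [gradient, ← ofReal_norm, ← ofReal_norm, LinearIsometryEquiv.norm_map]
  -- The derivative is continuous and sets of full measure are dense, so the essential bound holds
  -- everywhere.
  have hall : ∀ x, ‖fderiv ℝ f x‖ₑ ≤ lipConst f := by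
    have hcl : IsClosed {x | ‖fderiv ℝ f x‖ₑ ≤ lipConst f} := isClosed_le hc continuous_const
    have hd : Dense {x | ‖fderiv ℝ f x‖ₑ ≤ lipConst f} := Measure.dense_of_ae hae
    intro x
    have : x ∈ closure {x | ‖fderiv ℝ f x‖ₑ ≤ lipConst f} := hd x
    rwa [hcl.closure_eq] at this
  refine lipschitzWith_of_nnnorm_fderiv_le (hf.contDiff.differentiable (by norm_num)) fun x => ?_
  rw [← ENNReal.coe_le_coe, ENNReal.coe_toNNReal hM]
  exact hall x

theorem IsSupporting.isGraphFunction {f : EuclideanSpace ℝ (Fin n) → ℝ} (hf : IsSupporting f)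
    (hM : lipConst f ≤ 1) :
    IsGraphFunction (lastVec n) (fun x => f (horiz x)) (lipConst f).toNNReal where
  norm_eq := by simp [lastVec]
  invariant x t := by rw [horiz_add_smul_lastVec]
  lipschitz := by
    have h := (hf.lipschitzWith (ne_top_of_le_ne_top (by simp) hM)).comp lipschitzWith_horiz
    rwa [mul_one] at h
  le_one := by
    rw [← ENNReal.coe_le_coe, ENNReal.coe_toNNReal (ne_top_of_le_ne_top (by simp) hM)]
    exact hM

theorem above_eq_epigraph (f : EuclideanSpace ℝ (Fin n) → ℝ) :
    above (lastVec n) (fun x => f (horiz x)) = epigraph f := by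
  ext x
  simp [above, epigraph, depth, inner_lastVec]

theorem below_eq_hypograph (f : EuclideanSpace ℝ (Fin n) → ℝ) :
    below (lastVec n) (fun x => f (horiz x)) = hypograph f := by
  ext x
  simp [below, hypograph, depth, inner_lastVec]

theorem reflection_eq_vshift (f : EuclideanSpace ℝ (Fin n) → ℝ) (η : ℝ)
    (x : EuclideanSpace ℝ (Fin (n + 1))) :
    reflection f η x = vshift (lastVec n) (fun x => f (horiz x)) (1 + η) x := by
  ext i
  refine Fin.lastCases ?_ (fun j => ?_) i
  · have h : lastVec n (Fin.last n) = 1 := by simp [lastVec]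
    simp only [reflection, vshift, depth, inner_lastVec, vert, PiLp.add_apply, PiLp.smul_apply, h,
      Fin.snoc_last, smul_eq_mul]
    ring
  · simp [reflection, vshift, lastVec, (Fin.castSucc_lt_last j).ne]

/-- Normalizing the direction x - y costs |x - y|^p, hence the extra p in the exponent. On the
diagonal both integrands are 0. -/
theorem projSeminorm_eq {d : ℕ} {s p : ℝ} (hp : 0 < p)
    (Ω : Set (EuclideanSpace ℝ (Fin d)))
    (u : EuclideanSpace ℝ (Fin d) → EuclideanSpace ℝ (Fin d)) :
    projSeminorm s p Ω u = (∫⁻ x in Ω, ∫⁻ y in Ω,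
      projKernel p (Module.finrank ℝ (EuclideanSpace ℝ (Fin d)) + s * p + p) u x y) ^ (1 / p) := by
  rw [projSeminorm, finrank_euclideanSpace_fin]
  congr 1
  refine lintegral_congr fun x => lintegral_congr fun y => ?_
  rcases eq_or_ne x y with rfl | hxy
  · simp [projKernel, projDiff, Real.zero_rpow hp.ne', hp]
  · have hpos : 0 < ‖x - y‖ := norm_pos_iff.2 (sub_ne_zero.2 hxy)
    rw [projKernel, projDiff, inner_smul_right, abs_mul, abs_of_pos (inv_pos.2 hpos),
      Real.mul_rpow (by positivity) (by positivity), Real.inv_rpow hpos.le, ← ofReal_norm,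
      ← ofReal_norm, ENNReal.ofReal_rpow_of_nonneg (by positivity) hp.le,
      ENNReal.ofReal_rpow_of_pos hpos, ← ENNReal.ofReal_div_of_pos (by positivity),
      Real.rpow_add hpos _ p, Real.norm_eq_abs]
    congr 1
    field_simp

theorem gagliardoSeminorm_eq {d : ℕ} {s p : ℝ} (hp : 0 < p)
    (Ω : Set (EuclideanSpace ℝ (Fin d)))
    (u : EuclideanSpace ℝ (Fin d) → EuclideanSpace ℝ (Fin d)) :
    gagliardoSeminorm s p Ω u = (∫⁻ x in Ω, ∫⁻ y in Ω,
      diffKernel p (Module.finrank ℝ (EuclideanSpace ℝ (Fin d)) + s * p) u x y) ^ (1 / p) := by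
  rw [gagliardoSeminorm, finrank_euclideanSpace_fin]
  congr 1
  refine lintegral_congr fun x => lintegral_congr fun y => ?_
  rcases eq_or_ne x y with rfl | hxy
  · simp [diffKernel, Real.zero_rpow hp.ne', hp]
  · have hpos : 0 < ‖x - y‖ := norm_pos_iff.2 (sub_ne_zero.2 hxy)
    rw [diffKernel, ← ofReal_norm, ← ofReal_norm,
      ENNReal.ofReal_rpow_of_nonneg (by positivity) hp.le,
      ENNReal.ofReal_rpow_of_pos hpos, ← ENNReal.ofReal_div_of_pos (by positivity)]

end Epigraph

/-! ### Bounds in the norms of the statement. -/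

section Norms

variable {n : ℕ} {f : EuclideanSpace ℝ (Fin n) → ℝ}

theorem eq_zero_of_notMem_of_mem_C1c {d : ℕ} {Ω : Set (EuclideanSpace ℝ (Fin d))}
    {u : EuclideanSpace ℝ (Fin d) → EuclideanSpace ℝ (Fin d)} (hu : u ∈ C1c Ω)
    {x : EuclideanSpace ℝ (Fin d)} (hx : x ∉ Ω) : u x = 0 :=
  image_eq_zero_of_notMem_tsupport fun h => hx (hu.2.2 h)

theorem eq_zero_of_depth_nonneg
    {u : EuclideanSpace ℝ (Fin (n + 1)) → EuclideanSpace ℝ (Fin (n + 1))}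
    (hu : u ∈ C1c (epigraph f)) (x : EuclideanSpace ℝ (Fin (n + 1)))
    (hx : 0 ≤ depth (lastVec n) (fun x => f (horiz x)) x) : u x = 0 := by
  refine eq_zero_of_notMem_of_mem_C1c hu ?_
  rw [← above_eq_epigraph]
  exact not_lt.2 hx

theorem normC1_extendField_le (hf : IsSupporting f) (hM : lipConst f ≤ 1)
    {u : EuclideanSpace ℝ (Fin (n + 1)) → EuclideanSpace ℝ (Fin (n + 1))}
    (hu : u ∈ C1c (epigraph f)) :
    normC1 univ (extendField (lastVec n) (fun x => f (horiz x)) u)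
      ≤ 127 * normC1 (epigraph f) u := by
  have H := hf.isGraphFunction hM
  have hφ : ContDiff ℝ 1 fun x : EuclideanSpace ℝ (Fin (n + 1)) => f (horiz x) :=
    hf.contDiff.comp contDiff_horiz
  set A := ⨆ x ∈ epigraph f, ‖u x‖ₑ
  set B := ⨆ x ∈ epigraph f, ‖fderiv ℝ u x‖ₑ
  have hA (x) : ‖u x‖ₑ ≤ A := by
    by_cases hx : x ∈ epigraph f
    · exact le_iSup₂ (f := fun x (_ : x ∈ epigraph f) => ‖u x‖ₑ) x hx
    · simp [eq_zero_of_notMem_of_mem_C1c hu hx]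
  have hB (x) : ‖fderiv ℝ u x‖ₑ ≤ B := by
    by_cases hx : x ∈ epigraph f
    · exact le_iSup₂ (f := fun x (_ : x ∈ epigraph f) => ‖fderiv ℝ u x‖ₑ) x hx
    · have : fderiv ℝ u x = 0 := fderiv_of_notMem_tsupport ℝ fun h => hx (hu.2.2 h)
      rw [this, ← ofReal_norm, norm_zero, ENNReal.ofReal_zero]
      exact bot_le
  have h1 : ⨆ x ∈ (univ : Set (EuclideanSpace ℝ (Fin (n + 1)))),
      ‖extendField (lastVec n) (fun x => f (horiz x)) u x‖ₑ ≤ 127 * A := by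
    refine iSup₂_le fun x _ => (H.enorm_extendField_le u x).trans ?_
    calc _ ≤ A + 9 * A + 9 * A := by gcongr <;> exact hA _
      _ = 19 * A := by ring
      _ ≤ 127 * A := by gcongr; norm_num
  have h2 : ⨆ x ∈ (univ : Set (EuclideanSpace ℝ (Fin (n + 1)))),
      ‖fderiv ℝ (extendField (lastVec n) (fun x => f (horiz x)) u) x‖ₑ ≤ 127 * B := by
    refine iSup₂_le fun x _ => (H.enorm_fderiv_extendField_le hφ hu.1 x).trans ?_
    calc _ ≤ B + 63 * B + 63 * B := by gcongr <;> exact hB _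
      _ = 127 * B := by ring
  exact (add_le_add h1 h2).trans_eq (mul_add _ _ _).symm

theorem exists_projSeminorm_extendField_le (n : ℕ) {s p : ℝ} (hs : 0 < s) (hp : 1 < p) :
    ∃ C : ℝ≥0, ∀ f : EuclideanSpace ℝ (Fin n) → ℝ, IsSupporting f → lipConst f ≤ 1 →
      ∀ u ∈ C1c (epigraph f),
      projSeminorm s p univ (extendField (lastVec n) (fun x => f (horiz x)) u)
        ≤ C * (projSeminorm s p (epigraph f) u
          + lipConst f * gagliardoSeminorm s p (epigraph f) u) := by
  have hp0 : 0 < p := by linarith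
  obtain ⟨C, hC⟩ := exists_lintegral_projKernel_extendField_le
    (volume : Measure (EuclideanSpace ℝ (Fin (n + 1)))) hp0 (mul_pos hs hp0)
  refine ⟨C ^ (1 / p), fun f hf hM u hu => ?_⟩
  have h := hC _ _ _ (hf.isGraphFunction hM) u hu.1.continuous (eq_zero_of_depth_nonneg hu)
  rw [above_eq_epigraph, ENNReal.coe_toNNReal (ne_top_of_le_ne_top (by simp) hM)] at h
  have hq : 0 ≤ 1 / p := by positivity
  rw [projSeminorm_eq hp0, projSeminorm_eq hp0, gagliardoSeminorm_eq hp0, Measure.restrict_univ]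
  refine (ENNReal.rpow_le_rpow h hq).trans ?_
  rw [ENNReal.mul_rpow_of_nonneg _ _ hq, ENNReal.coe_rpow_of_nonneg _ hq]
  gcongr
  -- Subadditivity of the power 1 / p, valid as 1 / p ≤ 1; it turns `M ^ p` back into M.
  refine (ENNReal.rpow_add_le_add_rpow _ _ hq ((div_le_one hp0).2 hp.le)).trans ?_
  rw [ENNReal.mul_rpow_of_nonneg _ _ hq, ← ENNReal.rpow_mul, mul_one_div_cancel hp0.ne',
    ENNReal.rpow_one]

theorem exists_lpNorm_extendField_le (n : ℕ) {p : ℝ} (hp : 1 < p) :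
    ∃ C : ℝ≥0, ∀ f : EuclideanSpace ℝ (Fin n) → ℝ, IsSupporting f → lipConst f ≤ 1 →
      ∀ u ∈ C1c (epigraph f),
      lpNorm p univ (extendField (lastVec n) (fun x => f (horiz x)) u)
        ≤ C * lpNorm p (epigraph f) u := by
  set c : ℝ≥0∞ := 1 + 18 * (7 ^ Module.finrank ℝ (EuclideanSpace ℝ (Fin (n + 1))))
    ^ (1 / ENNReal.ofReal p).toReal
  have hc : c ≠ ∞ := ENNReal.add_ne_top.2 ⟨by simp, ENNReal.mul_ne_top (by simp)
    (ENNReal.rpow_ne_top_of_nonneg ENNReal.toReal_nonneg (ENNReal.pow_ne_top (by simp)))⟩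
  refine ⟨c.toNNReal, fun f hf hM u hu => ?_⟩
  have hsupp : Function.support u ⊆ epigraph f := (subset_tsupport u).trans hu.2.2
  rw [lpNorm, lpNorm, Measure.restrict_univ, eLpNorm_restrict_eq_of_support_subset hsupp,
    ENNReal.coe_toNNReal hc]
  exact (hf.isGraphFunction hM).eLpNorm_extendField_le volume
    (by simpa using ENNReal.ofReal_le_ofReal hp.le) (by simp) hu.1.continuous

theorem exists_normX_extendField_le (n : ℕ) {s p : ℝ} (hs : 0 < s) (hp : 1 < p) :
    ∃ C : ℝ≥0, ∀ f : EuclideanSpace ℝ (Fin n) → ℝ, IsSupporting f → lipConst f ≤ 1 →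
      ∀ u ∈ C1c (epigraph f),
      normX s p univ (extendField (lastVec n) (fun x => f (horiz x)) u)
        ≤ C * (normX s p (epigraph f) u + lipConst f * normW s p (epigraph f) u) := by
  obtain ⟨C₁, h₁⟩ := exists_projSeminorm_extendField_le n hs hp
  obtain ⟨C₂, h₂⟩ := exists_lpNorm_extendField_le n hp
  refine ⟨C₁ + C₂, fun f hf hM u hu => ?_⟩
  refine (add_le_add (h₁ f hf hM u hu) (h₂ f hf hM u hu)).trans ?_
  rw [normX, normW, ENNReal.coe_add, add_mul]
  gcongr
  · exact le_self_add
  · exact le_self_add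
  · exact le_add_self.trans le_self_add

end Norms

/-- The extension operator on compactly supported `C^1` fields. -/
noncomputable def extension {n : ℕ} {f : EuclideanSpace ℝ (Fin n) → ℝ} (hf : IsSupporting f)
    (hM : lipConst f ≤ 1) :
    C1c (epigraph f) →ₗ[ℝ] C1c (univ : Set (EuclideanSpace ℝ (Fin (n + 1)))) where
  toFun u := ⟨extendField (lastVec n) (fun x => f (horiz x)) u.1,
    contDiff_extendField (hf.contDiff.comp contDiff_horiz) u.2.1,
    (hf.isGraphFunction hM).hasCompactSupport_extendField u.2.2.1, subset_univ _⟩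
  map_add' u v := by
    ext1
    funext x
    simp only [Submodule.coe_add, Pi.add_apply, extendField_eq, map_add]
    abel
  map_smul' c u := by
    ext1
    funext x
    simp only [Submodule.coe_smul, Pi.smul_apply, extendField_eq, map_smul, smul_add,
      RingHom.id_apply]

theorem lastVec_castSucc {n : ℕ} (i : Fin n) : lastVec n i.castSucc = 0 := by
  simp [lastVec, (Fin.castSucc_lt_last i).ne]

theorem lastVec_last (n : ℕ) : lastVec n (Fin.last n) = 1 := by
  simp [lastVec]

end FracKorn

theorem proposition1p3 :
    ∃ M₀ : ℝ, 0 < M₀ ∧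
    ∃ lam mu k l m q : ℝ,
      0 < lam ∧ 0 < mu ∧ k + l = 1 ∧ m + q = 1 ∧ lam * k = -m ∧ mu * l = -q ∧
    ∀ (n : ℕ) (s p : ℝ), 0 < s → s < 1 → 1 < p →
    ∃ C : ℝ≥0,
    ∀ f : EuclideanSpace ℝ (Fin n) → ℝ,
      FracKorn.IsSupporting f → FracKorn.lipConst f < ENNReal.ofReal M₀ →
    ∃ E : FracKorn.C1c (FracKorn.epigraph f) →ₗ[ℝ]
        FracKorn.C1c (Set.univ : Set (EuclideanSpace ℝ (Fin (n + 1)))),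
      ∀ u : FracKorn.C1c (FracKorn.epigraph f),
        (∀ x ∈ FracKorn.epigraph f, (E u).1 x = u.1 x) ∧
        (∀ x ∈ FracKorn.hypograph f,
          (∀ i : Fin n, (E u).1 x i.castSucc =
            k * u.1 (FracKorn.reflection f lam x) i.castSucc
              + l * u.1 (FracKorn.reflection f mu x) i.castSucc) ∧
          (E u).1 x (Fin.last n) =
            m * u.1 (FracKorn.reflection f lam x) (Fin.last n)
              + q * u.1 (FracKorn.reflection f mu x) (Fin.last n)) ∧
        FracKorn.normC1 Set.univ (E u).1
          ≤ C * FracKorn.normC1 (FracKorn.epigraph f) u.1 ∧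
        FracKorn.normX s p Set.univ (E u).1
          ≤ C * (FracKorn.normX s p (FracKorn.epigraph f) u.1
              + FracKorn.lipConst f * FracKorn.normW s p (FracKorn.epigraph f) u.1) := by
  -- With λ = 1 and μ = 2 the relations become k + ℓ = 1 and -k - 2ℓ = 1, which force k = 3, ℓ = -2,
  -- m = -3 and n = 4.
  refine ⟨1, one_pos, 1, 2, 3, -2, -3, 4, by norm_num, by norm_num, by norm_num, by norm_num,
    by norm_num, by norm_num, fun n s p hs _ hp => ?_⟩
  obtain ⟨C, hC⟩ := FracKorn.exists_normX_extendField_le n hs hp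
  refine ⟨127 + C, fun f hf hM' => ?_⟩
  have hM : FracKorn.lipConst f ≤ 1 := by simpa using hM'.le
  refine ⟨FracKorn.extension hf hM, fun u => ⟨fun x hx => ?_, fun x hx => ?_, ?_, ?_⟩⟩
  · rw [← FracKorn.above_eq_epigraph] at hx
    exact (hf.isGraphFunction hM).extendField_of_above (FracKorn.eq_zero_of_depth_nonneg u.2) hx
  · rw [← FracKorn.below_eq_hypograph] at hx
    have h := FracKorn.IsGraphFunction.extendField_of_below
      (FracKorn.eq_zero_of_depth_nonneg u.2) hx
    -- The reflection with parameter η is `vshift` with parameter 1 + η.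
    have h1 : (1 : ℝ) + 1 = 2 := by norm_num
    have h2 : (1 : ℝ) + 2 = 3 := by norm_num
    rw [FracKorn.reflection_eq_vshift, FracKorn.reflection_eq_vshift, h1, h2]
    change (∀ i : Fin n, (FracKorn.extendField _ _ u.1 x) i.castSucc = _) ∧
      (FracKorn.extendField _ _ u.1 x) (Fin.last n) = _
    rw [h]
    simp only [FracKorn.inner_lastVec, FracKorn.vert, PiLp.add_apply, PiLp.sub_apply,
      PiLp.smul_apply, FracKorn.lastVec_castSucc, FracKorn.lastVec_last, smul_eq_mul]
    exact ⟨fun i => by ring, by ring⟩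
  · refine (FracKorn.normC1_extendField_le hf hM u.2).trans ?_
    gcongr
    rw [ENNReal.coe_add]
    exact le_self_add
  · refine (hC f hf hM u.1 u.2).trans ?_
    gcongr
    exact le_add_self
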